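/- Write $C_n$ for the cyclic group of order $n$, $D_n$ for the dihedral group of order $2n$, $Q_8$ for the quaternion group of order $8$, and $C_4\circ D_4$ for the central product of order $16$, i.e. the quotient of $C_4\times D_4$ by the subgroup of order $2$ generated by $(z,r^2)$, where $z$ is the element of order $2$ in $C_4$ and $r^2$ is the nontrivial central element of $D_4$. (a) Let $G$ and $K$ be groups. Then $G$ is a nonabelian group of order $16$ that has a subgroup $H\cong K$ of index $2$ such that $G$ is generated by the elements of order $2$ in $G\setminus H$, if and only if $(G,K)$ is, up to isomorphism, one of the four pairs $$(D_8,\,C_8),\qquad (C_2\times D_4,\; C_4\times C_2),\qquad (C_2\times D_4,\; D_4),\qquad (C_4\circ D_4,\; Q_8).$$ These four pairs are pairwise distinct: $D_8$, $C_2\times D_4$ and $C_4\circ D_4$ are pairwise nonisomorphic, and $C_4\times C_2\not\cong D_4$. (b) Let $F$ be a number field with odd class number, let $L/F$ be a normal extension of degree $16$ with nonabelian Galois group $G=\mathrm{Gal}(L/F)$, and let $k$ be a field with $F\subset k\subset L$ and $[k:F]=2$. If every finite prime is unramified in $L/k$, then $G$ is isomorphic to $D_8$, $C_2\times D_4$ or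 $C_4\circ D_4$. If moreover $L/k$ is unramified at the infinite places, then the pair $(G,\mathrm{Gal}(L/k))$ is, up to isomorphism, one of the four pairs in (a). -/

import Mathlib

/-- `G` is generated by the elements of order `2` lying outside the subgroup `H`. -/
def GeneratedByInvolutionsOutside {G : Type*} [Group G] (H : Subgroup G) : Prop :=
  Subgroup.closure {g : G | g ∉ H ∧ orderOf g = 2} = ⊤

/-- The cyclic group `C_n`, written multiplicatively. -/
abbrev Cyc (n : ℕ) : Type := Multiplicative (ZMod n)

/-- The subgroup of `C_4 × D_4` generated by the pair `(z, r²)`, where `z` is the element of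
order `2` of `C_4` and `r²` is the nontrivial central element of the dihedral group `D_4` of
order `8`. -/
abbrev amalgamatedCentre : Subgroup (Cyc 4 × DihedralGroup 4) :=
  Subgroup.zpowers (Multiplicative.ofAdd (2 : ZMod 4), DihedralGroup.r (2 : ZMod 4))

instance amalgamatedCentre_normal : amalgamatedCentre.Normal := by
  have hc : ∀ g : Cyc 4 × DihedralGroup 4,
      g * (Multiplicative.ofAdd (2 : ZMod 4), DihedralGroup.r (2 : ZMod 4)) =
        (Multiplicative.ofAdd (2 : ZMod 4), DihedralGroup.r (2 : ZMod 4)) * g := by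
    rintro ⟨a, b⟩
    have hb : ∀ b : DihedralGroup 4,
        b * DihedralGroup.r (2 : ZMod 4) = DihedralGroup.r (2 : ZMod 4) * b := by decide
    exact Prod.ext (mul_comm _ _) (hb b)
  refine ⟨fun n hn g => ?_⟩
  obtain ⟨k, rfl⟩ := Subgroup.mem_zpowers_iff.mp hn
  have h : Commute g
      ((Multiplicative.ofAdd (2 : ZMod 4), DihedralGroup.r (2 : ZMod 4)) ^ k) :=
    Commute.zpow_right (hc g) k
  rw [h.eq, mul_inv_cancel_right]
  exact hn

/-- The central product `C_4 ∘ D_4` (of order `16`): `C_4 × D_4` with the subgroup of order `2`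
of `C_4` identified with the centre of `D_4`. -/
abbrev C4CentralD4 : Type := (Cyc 4 × DihedralGroup 4) ⧸ amalgamatedCentre

/-- `(G, K)` is, up to isomorphism, one of the pairs `(D_8, C_8)`, `(C_2 × D_4, C_4 × C_2)`,
`(C_2 × D_4, D_4)`, `(C_4 ∘ D_4, Q_8)`. Here `D_n = DihedralGroup n` has order `2n`, and
`QuaternionGroup 2` is the quaternion group `Q_8` of order `8`. -/
def IsTablePair (G K : Type*) [Group G] [Group K] : Prop :=
  (Nonempty (G ≃* DihedralGroup 8) ∧ Nonempty (K ≃* Cyc 8)) ∨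
  (Nonempty (G ≃* (Cyc 2 × DihedralGroup 4)) ∧ Nonempty (K ≃* (Cyc 4 × Cyc 2))) ∨
  (Nonempty (G ≃* (Cyc 2 × DihedralGroup 4)) ∧ Nonempty (K ≃* DihedralGroup 4)) ∨
  (Nonempty (G ≃* C4CentralD4) ∧ Nonempty (K ≃* QuaternionGroup 2))

/-- `G` is, up to isomorphism, one of the groups `D_8`, `C_2 × D_4`, `C_4 ∘ D_4`. -/
def IsTableGroup (G : Type*) [Group G] : Prop :=
  Nonempty (G ≃* DihedralGroup 8) ∨
  Nonempty (G ≃* (Cyc 2 × DihedralGroup 4)) ∨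
  Nonempty (G ≃* C4CentralD4)

/-- The extension of number fields `L/k` is unramified at all finite primes: every nonzero prime
ideal of `𝓞 L` is unramified over `𝓞 k`. -/
def UnramifiedAtFinitePrimes (k L : Type*) [Field k] [Field L] [Algebra k L] : Prop :=
  ∀ (P : Ideal (NumberField.RingOfIntegers L)) [P.IsPrime], P ≠ ⊥ →
    Algebra.IsUnramifiedAt (NumberField.RingOfIntegers k) P

/-! Let S be a set of involutions generating a nonabelian group G of order 16. If a product of two
elements of S has order 8, G is dihedral. Otherwise take noncommuting a, b in S. Then x = ab has
order 4, x and t = a generate a dihedral group D of order 8, normal because of index 2, and some c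
in S lies outside D. Conjugation by c sends x to x or x⁻¹, and t to t or tx²: an odd power of x in
place of x² would give ct order 8. Each of the four actions yields an element u outside D that
centralizes D, with u² = 1 or u² = x², and this determines G. A subgroup of index 2 missing S
contains x and one of tc, txc, and this determines the subgroup (`isTable_of_closure_involutions`).
Conversely, each pair comes from the kernel of a character that is -1 on a generating set of
involutions, and the classification itself identifies that kernel.

For number fields, inertia groups at finite primes meet Gal(L/k) trivially, so their nontrivial
elements are involutions outside it; stabilizers of infinite places have order at most 2. If all
these groups lay in a proper subgroup, they would lie in one of index 2, whose fixed field K is a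
quadratic extension of F unramified everywhere (`eq_top_or_exists_unramified_quadratic`).

Such a K forces an even class number (`even_classNumber_of_unramified_quadratic`), without class
field theory. Let τ generate Gal(K/F). The infinite places split, so the unit rank goes from r to 2r
+ 1, and an index count gives a unit ε with τε = ε⁻¹ that is not of the form τη/η. As in Hilbert 90,
some a ≠ 0 has τa = εa. The ideal (a) is invariant, hence extended from an ideal J of F. Then J² is
principal, being the norm of (a), but J is not, by the choice of ε. -/

/-- The homomorphism from the cyclic group of order `n` sending the generator to `x`. -/
def cycLift {G : Type*} [Group G] (n : ℕ) (x : G) (hx : x ^ n = 1) : Cyc n →* G :=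
  AddMonoidHom.toMultiplicativeLeft
    (ZMod.lift n ⟨zmultiplesHom (Additive G) (Additive.ofMul x), by
      simp [← ofMul_pow, hx]⟩)

/-! ### Homomorphisms out of cyclic, dihedral and quaternion groups -/

section Lifts

variable {G : Type*} [Group G] {n : ℕ} {x : G} (hx : x ^ n = 1)

theorem cycLift_intCast (k : ℤ) : cycLift n x hx (Multiplicative.ofAdd (k : ZMod n)) = x ^ k := by
  change Additive.toMul (ZMod.lift n _ (k : ZMod n)) = x ^ k
  rw [ZMod.lift_coe]
  rfl

theorem cycLift_one : cycLift n x hx (Multiplicative.ofAdd 1) = x := by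
  simpa using cycLift_intCast hx 1

theorem exists_cycLift_eq_zpow (i : Cyc n) : ∃ k : ℤ, i = Multiplicative.ofAdd (k : ZMod n) ∧
    cycLift n x hx i = x ^ k := by
  obtain ⟨k, hk⟩ := ZMod.intCast_surjective i.toAdd
  exact ⟨k, by rw [hk]; rfl, by rw [← cycLift_intCast hx, hk]; rfl⟩

theorem cycLift_injective (h : orderOf x = n) : Function.Injective (cycLift n x hx) := by
  rw [injective_iff_map_eq_one]
  intro i hi
  obtain ⟨k, rfl, hk⟩ := exists_cycLift_eq_zpow hx i
  rw [hk, ← orderOf_dvd_iff_zpow_eq_one, h, ← ZMod.intCast_zmod_eq_zero_iff_dvd _ n] at hi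
  rw [hi]; rfl

theorem cycLift_mem_zpowers (i : Cyc n) : cycLift n x hx i ∈ Subgroup.zpowers x := by
  obtain ⟨k, -, hk⟩ := exists_cycLift_eq_zpow hx i
  exact hk ▸ Subgroup.zpow_mem_zpowers x k

theorem cycLift_ofAdd_sub (i j : ZMod n) : cycLift n x hx (Multiplicative.ofAdd (j - i)) =
    (cycLift n x hx (Multiplicative.ofAdd i))⁻¹ * cycLift n x hx (Multiplicative.ofAdd j) := by
  rw [sub_eq_neg_add, ofAdd_add, map_mul, ofAdd_neg, map_inv]

theorem cycLift_mul_of_inverts {t : G} (h : x * t = t * x⁻¹) (i : Cyc n) :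
    cycLift n x hx i * t = t * (cycLift n x hx i)⁻¹ := by
  obtain ⟨k, -, hk⟩ := exists_cycLift_eq_zpow hx i
  have h' : SemiconjBy t x⁻¹ x := h.symm
  rw [hk, ← inv_zpow]
  exact (h'.zpow_right k).eq.symm

/-- The homomorphism from a dihedral group given by a rotation `x` and a reflection `t`. -/
def dihedralLift {n : ℕ} (x t : G) (hx : x ^ n = 1) (ht : t * t = 1) (h : x * t = t * x⁻¹) :
    DihedralGroup n →* G :=
  MonoidHom.mk' (fun d => match d with
    | .r i => cycLift n x hx (Multiplicative.ofAdd i)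
    | .sr i => t * cycLift n x hx (Multiplicative.ofAdd i)) (by
    have key := cycLift_mul_of_inverts hx h
    rintro (i | i) (j | j)
    · simp [ofAdd_add]
    · simp only [DihedralGroup.r_mul_sr]
      rw [← mul_assoc, key, cycLift_ofAdd_sub, mul_assoc]
    · simp [ofAdd_add, mul_assoc]
    · simp only [DihedralGroup.sr_mul_sr]
      rw [mul_assoc, ← mul_assoc _ t, key, mul_assoc t, ← mul_assoc t, ht, one_mul, cycLift_ofAdd_sub])

/-- The homomorphism from a generalized quaternion group given by images `x`, `t` of its
standard generators. -/
def quaternionLift {n : ℕ} (x t : G) (hx : x ^ (2 * n) = 1) (ht : t * t = x ^ n)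
    (h : x * t = t * x⁻¹) : QuaternionGroup n →* G :=
  MonoidHom.mk' (fun d => match d with
    | .a i => cycLift (2 * n) x hx (Multiplicative.ofAdd i)
    | .xa i => t * cycLift (2 * n) x hx (Multiplicative.ofAdd i)) (by
    have key := cycLift_mul_of_inverts hx h
    have hn : cycLift (2 * n) x hx (Multiplicative.ofAdd (n : ZMod (2 * n))) = x ^ n := by
      simpa using cycLift_intCast hx n
    rintro (i | i) (j | j)
    · simp [ofAdd_add]
    · simp only [QuaternionGroup.a_mul_xa]
      rw [← mul_assoc, key, cycLift_ofAdd_sub, mul_assoc]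
    · simp [ofAdd_add, mul_assoc]
    · simp only [QuaternionGroup.xa_mul_xa]
      rw [mul_assoc, ← mul_assoc _ t, key, mul_assoc t, ← mul_assoc t, ht, add_sub_assoc, ofAdd_add,
        map_mul, hn, cycLift_ofAdd_sub])

theorem dihedralLift_injective {t : G} (ht : t * t = 1) (h : x * t = t * x⁻¹)
    (hn : orderOf x = n) (htx : t ∉ Subgroup.zpowers x) :
    Function.Injective (dihedralLift x t hx ht h) := by
  rw [injective_iff_map_eq_one]
  rintro (i | i) hi
  · change cycLift n x hx (Multiplicative.ofAdd i) = 1 at hi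
    rw [map_eq_one_iff _ (cycLift_injective hx hn)] at hi
    rw [ofAdd_eq_one.mp hi]; rfl
  · change t * cycLift n x hx (Multiplicative.ofAdd i) = 1 at hi
    exact absurd (eq_inv_of_mul_eq_one_left hi ▸ inv_mem (cycLift_mem_zpowers hx _)) htx

theorem quaternionLift_injective {t : G} (hx : x ^ (2 * n) = 1) (ht : t * t = x ^ n)
    (h : x * t = t * x⁻¹) (hn : orderOf x = 2 * n) (htx : t ∉ Subgroup.zpowers x) :
    Function.Injective (quaternionLift x t hx ht h) := by
  rw [injective_iff_map_eq_one]
  rintro (i | i) hi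
  · change cycLift (2 * n) x hx (Multiplicative.ofAdd i) = 1 at hi
    rw [map_eq_one_iff _ (cycLift_injective hx hn)] at hi
    rw [ofAdd_eq_one.mp hi]; rfl
  · change t * cycLift (2 * n) x hx (Multiplicative.ofAdd i) = 1 at hi
    exact absurd (eq_inv_of_mul_eq_one_left hi ▸ inv_mem (cycLift_mem_zpowers hx _)) htx

theorem mem_range_dihedralLift {t : G} (ht : t * t = 1) (h : x * t = t * x⁻¹) {g : G} :
    g ∈ (dihedralLift x t hx ht h).range ↔ ∃ k : ℤ, g = x ^ k ∨ g = t * x ^ k := by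
  constructor
  · rintro ⟨(i | i), rfl⟩
    · obtain ⟨k, -, hk⟩ := exists_cycLift_eq_zpow hx (Multiplicative.ofAdd i)
      exact ⟨k, .inl hk⟩
    · obtain ⟨k, -, hk⟩ := exists_cycLift_eq_zpow hx (Multiplicative.ofAdd i)
      exact ⟨k, .inr (congrArg (t * ·) hk)⟩
  · rintro ⟨k, rfl | rfl⟩
    · exact ⟨.r (k : ZMod n), cycLift_intCast hx k⟩
    · exact ⟨.sr (k : ZMod n), congrArg (t * ·) (cycLift_intCast hx k)⟩

/-- A power of `x` commutes with `x`; if it also inverted `x`, then `x ^ 2 = 1`. -/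
theorem notMem_zpowers_of_inverts {t : G} (h : x * t = t * x⁻¹) (hn : 2 < orderOf x) :
    t ∉ Subgroup.zpowers x := by
  intro hmem
  obtain ⟨k, rfl⟩ := Subgroup.mem_zpowers_iff.mp hmem
  rw [((Commute.refl x).zpow_right k).eq, mul_right_inj, eq_inv_iff_mul_eq_one, ← sq] at h
  exact absurd (orderOf_le_of_pow_eq_one two_pos h) (by omega)

end Lifts

/-! ### Recognizing subgroups and isomorphisms by counting -/

/-- A subgroup containing a subgroup of prime index properly is everything. -/
theorem Subgroup.eq_top_of_lt_of_two_mul_card {G : Type*} [Group G] [Finite G] {D R : Subgroup G}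
    (hD : 2 * Nat.card D = Nat.card G) (hlt : D < R) : R = ⊤ := by
  apply Subgroup.eq_top_of_le_card
  obtain ⟨k, hk⟩ := Subgroup.card_dvd_of_le hlt.le
  have h1 : Nat.card D < Nat.card R := Set.ncard_lt_ncard hlt
  have : 2 ≤ k := by
    by_contra! h
    interval_cases k <;> omega
  nlinarith

/-- An injective homomorphism into a subgroup of the same finite order is an isomorphism. -/
theorem MonoidHom.nonempty_mulEquiv_of_injective {G K : Type*} [Group G] [Group K] [Finite K]
    {H : Subgroup G} (f : K →* G) (hf : Function.Injective f) (hr : ∀ k, f k ∈ H)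
    (hc : Nat.card K = Nat.card H) : Nonempty (H ≃* K) := by
  have : Finite H := Nat.finite_of_card_ne_zero (hc ▸ Nat.card_pos.ne')
  exact ⟨(MulEquiv.ofBijective (f.codRestrict H hr)
    ((Nat.bijective_iff_injective_and_card _).mpr
      ⟨fun a b h => hf (congrArg Subtype.val h), hc⟩)).symm⟩

theorem MonoidHom.nonempty_mulEquiv_of_range_eq_top {G K : Type*} [Group G] [Group K] [Finite K]
    (f : K →* G) (hf : f.range = ⊤) (hc : Nat.card K = Nat.card G) : Nonempty (G ≃* K) :=
  ⟨(MulEquiv.ofBijective f ((Nat.bijective_iff_surjective_and_card _).mpr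
    ⟨MonoidHom.range_eq_top.mp hf, hc⟩)).symm⟩

theorem card_cyc (n : ℕ) : Nat.card (Cyc n) = n :=
  (Nat.card_congr Multiplicative.toAdd).trans (Nat.card_zmod n)

theorem card_C4CentralD4 : Nat.card C4CentralD4 = 16 := by
  have h := Subgroup.card_eq_card_quotient_mul_card_subgroup amalgamatedCentre
  have h2 : Nat.card amalgamatedCentre = 2 := by
    rw [Nat.card_zpowers]
    exact orderOf_eq_prime (by decide) (by decide)
  rw [h2, Nat.card_prod, card_cyc, DihedralGroup.nat_card] at h
  change _ = Nat.card C4CentralD4 * 2 at h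
  omega

/-! ### Groups of order 16 generated by a dihedral group of order 8 and one more element -/

section OrderSixteen

variable {G : Type*} [Group G] {x t u : G}

theorem card_range_dihedralLift (hx : x ^ 4 = 1) (ht : t * t = 1) (h : x * t = t * x⁻¹)
    (h4 : orderOf x = 4) : Nat.card (dihedralLift x t hx ht h).range = 8 := by
  rw [← Nat.card_congr (MonoidHom.ofInjective (dihedralLift_injective hx ht h h4
    (notMem_zpowers_of_inverts h (by omega)))).toEquiv, DihedralGroup.nat_card]

/-- The homomorphism from `C_n × D_m` given by commuting homomorphisms of the factors. -/
def cycDihedralLift {n m : ℕ} (hx : x ^ m = 1) (ht : t * t = 1) (h : x * t = t * x⁻¹)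
    (hu : u ^ n = 1) (hux : Commute u x) (hut : Commute u t) :
    Cyc n × DihedralGroup m →* G :=
  (cycLift n u hu).noncommCoprod (dihedralLift x t hx ht h) (by
    intro i d
    obtain ⟨k, -, hk⟩ := exists_cycLift_eq_zpow hu i
    rw [hk]
    apply Commute.zpow_left
    obtain ⟨j, hj | hj⟩ := (mem_range_dihedralLift hx ht h).mp ⟨d, rfl⟩
    · exact hj ▸ hux.zpow_right j
    · exact hj ▸ hut.mul_right (hux.zpow_right j))

theorem cycDihedralLift_one_right {n m : ℕ} (hx : x ^ m = 1) (ht : t * t = 1)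
    (h : x * t = t * x⁻¹) (hu : u ^ n = 1) (hux : Commute u x) (hut : Commute u t) (i : Cyc n) :
    cycDihedralLift hx ht h hu hux hut (i, 1) = cycLift n u hu i := by
  simp [cycDihedralLift]

theorem cycDihedralLift_one_left {n m : ℕ} (hx : x ^ m = 1) (ht : t * t = 1)
    (h : x * t = t * x⁻¹) (hu : u ^ n = 1) (hux : Commute u x) (hut : Commute u t)
    (d : DihedralGroup m) :
    cycDihedralLift hx ht h hu hux hut (1, d) = dihedralLift x t hx ht h d := by
  simp [cycDihedralLift]

/-- The image contains a subgroup of index 2 and the element `u` outside it. -/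
theorem range_cycDihedralLift_eq_top {n : ℕ} (hG : Nat.card G = 16) (hx : x ^ 4 = 1)
    (ht : t * t = 1) (h : x * t = t * x⁻¹) (h4 : orderOf x = 4) (hu : u ^ n = 1)
    (hux : Commute u x) (hut : Commute u t) (huD : u ∉ (dihedralLift x t hx ht h).range) :
    (cycDihedralLift hx ht h hu hux hut).range = ⊤ := by
  have : Finite G := Nat.finite_of_card_ne_zero (by omega)
  refine Subgroup.eq_top_of_lt_of_two_mul_card
    (D := (dihedralLift x t hx ht h).range) (by rw [card_range_dihedralLift hx ht h h4, hG]) ?_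
  refine SetLike.lt_iff_le_and_exists.mpr
    ⟨?_, u, MonoidHom.mem_range.mpr ⟨(Multiplicative.ofAdd 1, 1), ?_⟩, huD⟩
  · rintro _ ⟨d, rfl⟩
    exact ⟨(1, d), cycDihedralLift_one_left hx ht h hu hux hut d⟩
  · rw [cycDihedralLift_one_right, cycLift_one]

theorem nonempty_mulEquiv_cyc_two_prod_dihedral (hG : Nat.card G = 16) (hx : x ^ 4 = 1)
    (ht : t * t = 1) (h : x * t = t * x⁻¹) (h4 : orderOf x = 4) (hu : u * u = 1)
    (hux : Commute u x) (hut : Commute u t) (huD : u ∉ (dihedralLift x t hx ht h).range) :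
    Nonempty (G ≃* (Cyc 2 × DihedralGroup 4)) := by
  refine MonoidHom.nonempty_mulEquiv_of_range_eq_top _
    (range_cycDihedralLift_eq_top hG hx ht h h4 (n := 2) ((sq u).trans hu) hux hut huD) ?_
  rw [Nat.card_prod, card_cyc, DihedralGroup.nat_card, hG]

theorem nonempty_mulEquiv_C4CentralD4 (hG : Nat.card G = 16) (hx : x ^ 4 = 1)
    (ht : t * t = 1) (h : x * t = t * x⁻¹) (h4 : orderOf x = 4) (hu : u * u = x * x)
    (hux : Commute u x) (hut : Commute u t) (huD : u ∉ (dihedralLift x t hx ht h).range) :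
    Nonempty (G ≃* C4CentralD4) := by
  have hu4 : u ^ 4 = 1 := by rw [pow_mul u 2 2, sq u, hu, ← sq x, ← pow_mul, hx]
  let f := cycDihedralLift (n := 4) hx ht h hu4 hux hut
  -- The generator of the amalgamated subgroup maps to `u ^ 2 * x ^ 2 = x ^ 4 = 1`.
  have hf : amalgamatedCentre ≤ f.ker := by
    rw [Subgroup.zpowers_le, MonoidHom.mem_ker]
    have h1 : cycLift 4 u hu4 (Multiplicative.ofAdd 2) = u ^ 2 := by
      exact_mod_cast cycLift_intCast hu4 2
    have h2 : dihedralLift x t hx ht h (DihedralGroup.r 2) = x ^ 2 := by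
      exact_mod_cast cycLift_intCast hx 2
    change cycLift 4 u hu4 (Multiplicative.ofAdd 2) *
      dihedralLift x t hx ht h (DihedralGroup.r 2) = 1
    rw [h1, h2, sq u, hu, ← sq x, ← pow_add, hx]
  have : Finite C4CentralD4 := Nat.finite_of_card_ne_zero (by rw [card_C4CentralD4]; norm_num)
  refine MonoidHom.nonempty_mulEquiv_of_range_eq_top (QuotientGroup.lift _ f hf) ?_
    (by rw [card_C4CentralD4, hG])
  rw [eq_top_iff, ← range_cycDihedralLift_eq_top hG hx ht h h4 hu4 hux hut huD]
  rintro _ ⟨p, rfl⟩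
  exact ⟨QuotientGroup.mk p, rfl⟩

/-- The table pairs, when the involutions `t`, `t * x` and `c` generate, do not lie in `H`, and
`t`, `t * x` generate a dihedral group of order `8` not containing `c`. -/
theorem isTable_of_orderOf_eq_four {c : G} (hG : Nat.card G = 16) (hx : x ^ 4 = 1)
    (ht : t * t = 1) (h : x * t = t * x⁻¹) (h4 : orderOf x = 4) (hc : c * c = 1)
    (hcD : c ∉ (dihedralLift x t hx ht h).range)
    (hcx : c * x * c = x ∨ c * x * c = x⁻¹) (hct : c * t * c = t ∨ c * t * c = t * (x * x)) :
    IsTableGroup G ∧ ∀ H : Subgroup G, H.index = 2 → t ∉ H → t * x ∉ H → c ∉ H →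
      IsTablePair G H := by
  have : Finite G := Nat.finite_of_card_ne_zero (by omega)
  have hcard : ∀ H : Subgroup G, H.index = 2 → Nat.card H = 8 := by
    intro H hH
    have := H.card_mul_index
    rw [hH, hG] at this
    omega
  have hxH : ∀ H : Subgroup G, H.index = 2 → t ∉ H → t * x ∉ H → x ∈ H := by
    intro H hH h1 h2
    rw [Subgroup.mul_mem_iff_of_index_two hH] at h2
    tauto
  set D := (dihedralLift x t hx ht h).range
  have hxD : x ∈ D := (mem_range_dihedralLift hx ht h).mpr ⟨1, .inl (zpow_one x).symm⟩
  have htD : t ∈ D := (mem_range_dihedralLift hx ht h).mpr ⟨0, .inr (by simp)⟩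
  have hzD : ∀ g, g ∉ D → g ∉ Subgroup.zpowers x := fun g hg h' =>
    hg ((Subgroup.zpowers_le.mpr hxD) h')
  have hconj : ∀ a b : G, c * a * c = b → c * a = b * c := by
    rintro a b rfl
    rw [mul_assoc _ c c, hc, mul_one]
  -- a central involution `u ∈ H` outside `D`
  have key : ∀ u : G, u ∉ D → u * u = 1 → Commute u x → Commute u t →
      (∀ H : Subgroup G, H.index = 2 → t ∉ H → t * x ∉ H → c ∉ H → u ∈ H) →
      IsTableGroup G ∧ ∀ H : Subgroup G, H.index = 2 → t ∉ H → t * x ∉ H → c ∉ H →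
        IsTablePair G H := by
    intro u huD huu hux hut huH
    have e := nonempty_mulEquiv_cyc_two_prod_dihedral hG hx ht h h4 huu hux hut huD
    refine ⟨.inr (.inl e), fun H hH h1 h2 h3 => .inr (.inl ⟨e, ?_⟩)⟩
    have hu2 : u ^ 2 = 1 := (sq u).trans huu
    have hu1 : u ≠ 1 := fun h1 => huD (h1 ▸ one_mem _)
    let f : Cyc 4 × Cyc 2 →* G := (cycLift 4 x hx).noncommCoprod (cycLift 2 u hu2) (by
      intro i j
      obtain ⟨k, -, hk⟩ := exists_cycLift_eq_zpow hx i
      obtain ⟨l, -, hl⟩ := exists_cycLift_eq_zpow hu2 j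
      rw [hk, hl]
      exact (hux.symm.zpow_right l).zpow_left k)
    have hf : ∀ p, f p = cycLift 4 x hx p.1 * cycLift 2 u hu2 p.2 := fun p => rfl
    have hxH := hxH H hH h1 h2
    have huH := huH H hH h1 h2 h3
    refine MonoidHom.nonempty_mulEquiv_of_injective f ?_ ?_ ?_
    · refine (MonoidHom.noncommCoprod_injective _ _ _).mpr ⟨cycLift_injective hx h4,
        cycLift_injective hu2 (orderOf_eq_prime hu2 hu1), ?_⟩
      rw [Subgroup.disjoint_def]
      rintro _ ⟨i, rfl⟩ ⟨j, hj⟩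
      obtain ⟨k, hk, -⟩ := exists_cycLift_eq_zpow hu2 j
      -- An odd power of `u` equals `u`, which is not in `D` and so not a power of `x`.
      obtain ⟨l, hl⟩ := Int.even_or_odd' k
      have hmem := hj ▸ (Subgroup.zpowers_le.mpr hxD) (cycLift_mem_zpowers hx i)
      rw [← hj]
      rw [hk, cycLift_intCast] at hmem ⊢
      rcases hl with rfl | rfl
      · rw [zpow_mul, zpow_two, huu, one_zpow]
      · rw [zpow_add, zpow_mul, zpow_two, huu, one_zpow, one_mul, zpow_one] at hmem
        exact absurd hmem huD
    · intro p
      rw [hf]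
      exact mul_mem ((Subgroup.zpowers_le.mpr hxH) (cycLift_mem_zpowers hx _))
        ((Subgroup.zpowers_le.mpr huH) (cycLift_mem_zpowers hu2 _))
    · rw [hcard H hH, Nat.card_prod, card_cyc, card_cyc]
  rcases hcx with hcx | hcx <;> rcases hct with hct | hct
  -- Here `c` itself centralizes `D`; `H` contains `x` and the involution `t * c`, which inverts
  -- `x`.
  · have hcx' : Commute c x := hconj _ _ hcx
    have hct' : Commute c t := hconj _ _ hct
    have e := nonempty_mulEquiv_cyc_two_prod_dihedral hG hx ht h h4 hc hcx' hct' hcD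
    refine ⟨.inr (.inl e), fun H hH h1 h2 h3 => .inr (.inr (.inl ⟨e, ?_⟩))⟩
    have hyy : (t * c) * (t * c) = 1 := by
      rw [mul_assoc, ← mul_assoc c, hct'.eq, mul_assoc t c c, hc, mul_one, ht]
    have hxy : x * (t * c) = t * c * x⁻¹ := by
      rw [← mul_assoc, h, mul_assoc, mul_assoc, (hcx'.inv_right).eq]
    have hyH : t * c ∈ H := by
      rw [Subgroup.mul_mem_iff_of_index_two hH]; tauto
    refine MonoidHom.nonempty_mulEquiv_of_injective (dihedralLift x (t * c) hx hyy hxy)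
      (dihedralLift_injective hx hyy hxy h4 (hzD _ fun hy => hcD ?_)) (fun k => ?_) ?_
    · exact (Subgroup.mul_mem_cancel_left _ htD).mp hy
    · have hxH := hxH H hH h1 h2
      obtain ⟨j, hj | hj⟩ := (mem_range_dihedralLift hx hyy hxy).mp ⟨k, rfl⟩
      · exact hj ▸ zpow_mem hxH j
      · exact hj ▸ mul_mem hyH (zpow_mem hxH j)
    · rw [hcard H hH, DihedralGroup.nat_card]
  -- Here `x * c` centralizes `D` and has square `x * x`. In `H`, the element `t * c` inverts `x`
  -- and has square `x ^ 2`, which is the quaternion relation.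
  · have hcx' : Commute c x := hconj _ _ hcx
    have hct' : c * t = t * (x * x) * c := hconj _ _ hct
    have huu : (x * c) * (x * c) = x * x := by
      rw [mul_assoc, ← mul_assoc c, hcx'.eq, mul_assoc x c c, hc, mul_one]
    have hux : Commute (x * c) x := (Commute.refl x).mul_left hcx'
    have hut : Commute (x * c) t := by
      change x * c * t = t * (x * c)
      rw [mul_assoc, hct', ← mul_assoc, ← mul_assoc, h]
      group
    have huD : x * c ∉ D := fun hy => hcD ((Subgroup.mul_mem_cancel_left _ hxD).mp hy)
    have e := nonempty_mulEquiv_C4CentralD4 hG hx ht h h4 huu hux hut huD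
    refine ⟨.inr (.inr e), fun H hH h1 h2 h3 => .inr (.inr (.inr ⟨e, ?_⟩))⟩
    have hyy : (t * c) * (t * c) = x ^ 2 := by
      rw [mul_assoc, ← mul_assoc c, hct', mul_assoc _ c c, hc, mul_one, ← mul_assoc, ht, one_mul,
        sq]
    have hxy : x * (t * c) = t * c * x⁻¹ := by
      rw [← mul_assoc, h, mul_assoc, mul_assoc, (hcx'.inv_right).eq]
    have hyH : t * c ∈ H := by
      rw [Subgroup.mul_mem_iff_of_index_two hH]; tauto
    have hxH := hxH H hH h1 h2
    refine MonoidHom.nonempty_mulEquiv_of_injective (quaternionLift (n := 2) x (t * c) hx hyy hxy)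
      (quaternionLift_injective hx hyy hxy h4 (hzD _ fun hy => hcD ?_)) ?_ ?_
    · exact (Subgroup.mul_mem_cancel_left _ htD).mp hy
    · rintro (i | i)
      · exact (Subgroup.zpowers_le.mpr hxH) (cycLift_mem_zpowers hx _)
      · exact mul_mem hyH ((Subgroup.zpowers_le.mpr hxH) (cycLift_mem_zpowers hx _))
    · rw [hcard H hH, Nat.card_eq_fintype_card, QuaternionGroup.card]
  -- Both `c` and `t` invert `x`, so `t * c` centralizes `D`.
  · have hcx' : c * x = x⁻¹ * c := hconj _ _ hcx
    have hct' : Commute c t := hconj _ _ hct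
    refine key (t * c) (fun hy => hcD ((Subgroup.mul_mem_cancel_left _ htD).mp hy)) ?_ ?_ ?_ ?_
    · rw [mul_assoc, ← mul_assoc c, hct'.eq, mul_assoc t c c, hc, mul_one, ht]
    · change t * c * x = x * (t * c)
      rw [mul_assoc, hcx', ← mul_assoc, ← h, mul_assoc]
    · exact (Commute.refl t).mul_left hct'
    · intro H hH h1 h2 h3
      rw [Subgroup.mul_mem_iff_of_index_two hH]; tauto
  -- `c` acts on `D` as conjugation by `t * x`, so `t * x * c` centralizes `D`. It lies in `H` as
  -- the product of two elements outside.
  · have hcx' : c * x = x⁻¹ * c := hconj _ _ hcx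
    have hct' : c * t = t * (x * x) * c := hconj _ _ hct
    have hctx : Commute c (t * x) := by
      change c * (t * x) = t * x * c
      rw [← mul_assoc, hct', mul_assoc _ c, hcx']
      group
    have hbb : t * x * (t * x) = 1 := by
      rw [mul_assoc, ← mul_assoc x, h, inv_mul_cancel_right, ht]
    refine key (t * x * c) (fun hy => hcD ((Subgroup.mul_mem_cancel_left _
      (mul_mem htD hxD)).mp hy)) ?_ ?_ ?_ ?_
    · rw [mul_assoc, ← mul_assoc c, hctx.eq, mul_assoc _ c c, hc, mul_one, hbb]
    · change t * x * c * x = x * (t * x * c)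
      rw [mul_assoc, hcx', ← mul_assoc, mul_inv_cancel_right, ← mul_assoc, ← mul_assoc, h,
        inv_mul_cancel_right]
    · change t * x * c * t = t * (t * x * c)
      rw [mul_assoc, hct', ← mul_assoc, ← mul_assoc, mul_assoc t x t, h, ← mul_assoc, ← mul_assoc,
        ← mul_assoc, ht]
      group
      rw [ht, one_mul]
    · intro H hH h1 h2 h3
      rw [Subgroup.mul_mem_iff_of_index_two hH]; tauto

end OrderSixteen

/-! ### Classification of the groups of order 16 generated by involutions -/

section Classification

variable {G : Type*} [Group G]

theorem mul_mul_eq_mul_mul_inv_of_involutions {a b : G} (ha : a * a = 1) (hb : b * b = 1) :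
    a * b * a = a * (a * b)⁻¹ := by
  rw [mul_inv_rev, inv_eq_of_mul_eq_one_left ha, inv_eq_of_mul_eq_one_left hb, mul_assoc]

/-- The rotation `a * b` and the reflection `a` already account for 16 elements. A product of two
elements outside `H` lies in `H`, so `a * b` generates `H`. -/
theorem isTable_of_orderOf_eq_eight {a b : G} (hG : Nat.card G = 16) (ha : a * a = 1)
    (hb : b * b = 1) (h8 : orderOf (a * b) = 8) :
    IsTableGroup G ∧ ∀ H : Subgroup G, H.index = 2 → a ∉ H → b ∉ H → IsTablePair G H := by
  have : Finite G := Nat.finite_of_card_ne_zero (by omega)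
  have hx : (a * b) ^ 8 = 1 := h8 ▸ pow_orderOf_eq_one _
  have h := mul_mul_eq_mul_mul_inv_of_involutions ha hb
  have e : Nonempty (G ≃* DihedralGroup 8) := by
    refine ⟨(MulEquiv.ofBijective (dihedralLift (a * b) a hx ha h)
      ((Nat.bijective_iff_injective_and_card _).mpr
        ⟨dihedralLift_injective hx ha h h8 (notMem_zpowers_of_inverts h (by omega)), ?_⟩)).symm⟩
    rw [DihedralGroup.nat_card, hG]
  refine ⟨.inl e, fun H hH h1 h2 => .inl ⟨e, ?_⟩⟩
  have hxH : a * b ∈ H := by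
    rw [Subgroup.mul_mem_iff_of_index_two hH]; tauto
  refine MonoidHom.nonempty_mulEquiv_of_injective (cycLift 8 (a * b) hx)
    (cycLift_injective hx h8) (fun k => (Subgroup.zpowers_le.mpr hxH) (cycLift_mem_zpowers hx k)) ?_
  have := H.card_mul_index
  rw [hH, hG] at this
  rw [card_cyc]
  omega

theorem zpow_eq_of_pow_four_eq_one {x : G} (hx : x ^ 4 = 1) (k : ℤ) :
    x ^ k = 1 ∨ x ^ k = x ∨ x ^ k = x * x ∨ x ^ k = x⁻¹ := by
  have h : x ^ k = x ^ (k % 4) := by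
    conv_lhs => rw [← Int.emod_add_mul_ediv k 4, zpow_add, zpow_mul]
    have : x ^ (4 : ℤ) = 1 := by exact_mod_cast hx
    rw [this, one_zpow, mul_one]
  have h1 := Int.emod_nonneg k (by norm_num : (4 : ℤ) ≠ 0)
  have h2 := Int.emod_lt_of_pos k (by norm_num : (0 : ℤ) < 4)
  rw [h]
  have h3 : x ^ 3 = x⁻¹ := eq_inv_of_mul_eq_one_left (by rw [← pow_succ, hx])
  generalize k % 4 = m at *
  interval_cases m
  · simp
  · simp
  · exact .inr (.inr (.inl (zpow_two x)))
  · exact .inr (.inr (.inr (by exact_mod_cast h3)))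

/-- The action of an involution `c` normalizing the dihedral group generated by `x` and `t`. -/
theorem conj_dihedral_of_normal {x t c : G} (hx : x ^ 4 = 1) (h4 : orderOf x = 4)
    (ht : t * t = 1) (h : x * t = t * x⁻¹) (hc : c * c = 1)
    (hn : (dihedralLift x t hx ht h).range.Normal) :
    (c * x * c = x ∨ c * x * c = x⁻¹) ∧
      (c * t * c = t ∨ c * t * c = t * (x * x) ∨ orderOf (c * t) = 8) := by
  have hci : c⁻¹ = c := inv_eq_of_mul_eq_one_left hc
  have hxx : x * x ≠ 1 := fun h' => by
    have := orderOf_le_of_pow_eq_one two_pos ((sq x).trans h')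
    omega
  have hx4 : x * x * (x * x) = 1 := by rw [← hx]; simp only [pow_succ, pow_zero, one_mul, mul_assoc]
  have htz : t ∉ Subgroup.zpowers x := notMem_zpowers_of_inverts h (by omega)
  have hconj : ∀ g h : G, c * g * c * (c * h * c) = c * (g * h) * c := by
    intro g h
    rw [mul_assoc (c * g), ← mul_assoc c (c * h), ← mul_assoc c c, hc, one_mul]
    simp only [mul_assoc]
  have hinj : ∀ g h : G, c * g * c = c * h * c → g = h := fun g h h' =>
    mul_left_cancel (mul_right_cancel h')
  have hmem : ∀ g ∈ (dihedralLift x t hx ht h).range, ∃ k : ℤ,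
      c * g * c = x ^ k ∨ c * g * c = t * x ^ k := by
    intro g hg
    have := hn.conj_mem g hg c
    rw [hci] at this
    exact (mem_range_dihedralLift hx ht h).mp this
  have hrefl : ∀ k : ℤ, t * x ^ k * (t * x ^ k) = 1 := by
    intro k
    have : x ^ k * t = t * (x ^ k)⁻¹ := by
      have h' : SemiconjBy t x⁻¹ x := h.symm
      rw [← inv_zpow]
      exact (h'.zpow_right k).eq.symm
    rw [mul_assoc, ← mul_assoc _ t, this, inv_mul_cancel_right, ht]
  -- Conjugation keeps the square nontrivial, which rules out the reflections and the rotations 1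
  -- and `x * x`.
  have hcx : c * x * c = x ∨ c * x * c = x⁻¹ := by
    have h2 : c * x * c * (c * x * c) ≠ 1 := by
      rw [hconj]
      intro h'
      exact hxx (hinj _ _ (h'.trans (by rw [mul_one, hc])))
    obtain ⟨k, hk | hk⟩ := hmem x ((mem_range_dihedralLift hx ht h).mpr ⟨1, .inl (by simp)⟩)
    · rcases zpow_eq_of_pow_four_eq_one hx k with e | e | e | e <;> rw [e] at hk
      · exact absurd (by rw [hk, one_mul]) h2
      · exact .inl hk
      · exact absurd (by rw [hk, hx4]) h2
      · exact .inr hk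
    · exact absurd (by rw [hk, hrefl]) h2
  refine ⟨hcx, ?_⟩
  -- A power of `x` commutes with `c * x * c`; conjugating back, `t` would commute with `x`.
  have hncomm : ∀ k : ℤ, c * t * c ≠ x ^ k := by
    intro k hk
    have hcomm : ∀ g : G, g = x ∨ g = x⁻¹ → x ^ k * g = g * x ^ k := by
      rintro g (rfl | rfl)
      · exact (Commute.refl g).zpow_left k
      · exact ((Commute.refl x).inv_right).zpow_left k
    have h' := hcomm _ hcx
    rw [← hk, hconj, hconj] at h'
    have h'' := hinj _ _ h'
    rw [h, mul_right_inj, eq_inv_iff_mul_eq_one] at h''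
    exact hxx h''
  obtain ⟨k, hk | hk⟩ := hmem t ((mem_range_dihedralLift hx ht h).mpr ⟨0, .inr (by simp)⟩)
  · exact absurd hk (hncomm k)
  -- Used for `y = x` and `y = x⁻¹`: then `(c * t) ^ 2 = y⁻¹` has order 4.
  have horder : ∀ y : G, y ^ 4 = x ^ 4 → y * y ≠ 1 → c * t * c = t * y → y * t = t * y⁻¹ →
      orderOf (c * t) = 8 := by
    intro y hy hyy e1 e2
    have hsq : (c * t) ^ 2 = y⁻¹ := by
      rw [sq, ← mul_assoc, e1, mul_assoc, e2, ← mul_assoc, ht, one_mul]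
    refine orderOf_eq_prime_pow (p := 2) (n := 2) ?_ ?_
    · change ¬ (c * t) ^ (2 * 2) = 1
      rw [pow_mul, hsq, sq, ← mul_inv_rev, inv_eq_one]
      exact hyy
    · change (c * t) ^ (2 * 4) = 1
      rw [pow_mul, hsq, inv_pow, hy, hx, inv_one]
  rcases zpow_eq_of_pow_four_eq_one hx k with e | e | e | e <;> rw [e] at hk
  · exact .inl (by rw [hk, mul_one])
  · exact .inr (.inr (horder x rfl hxx hk h))
  · exact .inr (.inl hk)
  · refine .inr (.inr (horder x⁻¹ (by rw [inv_pow, hx, inv_one]) ?_ hk ?_))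
    · rw [← mul_inv_rev, ne_eq, inv_eq_one]; exact hxx
    · rw [inv_inv, inv_mul_eq_iff_eq_mul, ← mul_assoc, h, inv_mul_cancel_right]

/-- A nonabelian group of order `16` generated by a set `S` of involutions is in the table, and
so are its subgroups of index `2` disjoint from `S`. -/
theorem isTable_of_closure_involutions (hG : Nat.card G = 16)
    (hna : ¬ ∀ a b : G, a * b = b * a) (S : Set G) (hS : ∀ s ∈ S, s * s = 1)
    (hgen : Subgroup.closure S = ⊤) :
    IsTableGroup G ∧ ∀ H : Subgroup G, H.index = 2 → (∀ s ∈ S, s ∉ H) → IsTablePair G H := by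
  have : Finite G := Nat.finite_of_card_ne_zero (by omega)
  by_cases h8 : ∃ a ∈ S, ∃ b ∈ S, orderOf (a * b) = 8
  · obtain ⟨a, ha, b, hb, h8⟩ := h8
    have := isTable_of_orderOf_eq_eight hG (hS a ha) (hS b hb) h8
    exact ⟨this.1, fun H hH h => this.2 H hH (h a ha) (h b hb)⟩
  push Not at h8
  obtain ⟨a, ha, b, hb, hab⟩ : ∃ a ∈ S, ∃ b ∈ S, a * b ≠ b * a := by
    by_contra! hcomm
    have := Subgroup.isMulCommutative_closure hcomm
    refine hna fun a b => ?_
    have h := this.is_comm.comm ⟨a, hgen ▸ Subgroup.mem_top a⟩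
      ⟨b, hgen ▸ Subgroup.mem_top b⟩
    exact congrArg Subtype.val h
  have ht := hS a ha
  have hbb := hS b hb
  have h := mul_mul_eq_mul_mul_inv_of_involutions ht hbb
  have hxx : (a * b) ^ 2 ≠ 1 := by
    intro h'
    rw [sq, mul_eq_one_iff_eq_inv, mul_inv_rev, inv_eq_of_mul_eq_one_left ht,
      inv_eq_of_mul_eq_one_left hbb] at h'
    exact hab h'
  have h4 : orderOf (a * b) = 4 := by
    have hd : orderOf (a * b) ∣ 2 ^ 4 := by
      have := orderOf_dvd_natCard (a * b)
      rwa [hG] at this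
    obtain ⟨m, hm, hm'⟩ := (Nat.dvd_prime_pow Nat.prime_two).mp hd
    interval_cases m
    · exact absurd (orderOf_eq_one_iff.mp hm') fun h1 => hxx (by rw [h1, one_pow])
    · exact absurd (by rw [← pow_orderOf_eq_one (a * b), hm']; rfl) hxx
    · exact hm'
    · exact absurd hm' (h8 a ha b hb)
    -- If the order were 16, `a` would be a power of `a * b`, which it inverts.
    · have := notMem_zpowers_of_inverts h (by omega)
      refine absurd ?_ this
      have htop : Subgroup.zpowers (a * b) = ⊤ := by
        apply Subgroup.eq_top_of_card_eq
        rw [Nat.card_zpowers, hm', hG]; rfl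
      rw [htop]; exact Subgroup.mem_top a
  have hx : (a * b) ^ 4 = 1 := h4 ▸ pow_orderOf_eq_one _
  set D := (dihedralLift (a * b) a hx ht h).range with hD
  have hDcard := card_range_dihedralLift hx ht h h4
  obtain ⟨c, hc, hcD⟩ : ∃ c ∈ S, c ∉ D := by
    by_contra! hle
    have htop : D = ⊤ := top_le_iff.mp (hgen ▸ (Subgroup.closure_le D).mpr hle)
    rw [← hD, htop, Subgroup.card_top] at hDcard
    omega
  have hDi : D.index = 2 := by
    have := D.card_mul_index
    rw [hDcard, hG] at this
    omega
  have hconj := conj_dihedral_of_normal hx h4 ht h (hS c hc) (Subgroup.normal_of_index_eq_two hDi)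
  have hct : c * a * c = a ∨ c * a * c = a * (a * b * (a * b)) := by
    rcases hconj.2 with h' | h' | h'
    · exact .inl h'
    · exact .inr h'
    · exact absurd h' (h8 c hc a ha)
  have := isTable_of_orderOf_eq_four hG hx ht h h4 (hS c hc) hcD hconj.1 hct
  refine ⟨this.1, fun H hH hSH => this.2 H hH (hSH a ha) ?_ (hSH c hc)⟩
  -- With `x = a * b` and `t = a`, the reflection `t * x` is `b`.
  rw [← mul_assoc, ht, one_mul]
  exact hSH b hb

theorem IsTablePair.of_mulEquiv {G K G' K' : Type*} [Group G] [Group K] [Group G'] [Group K']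
    (h : IsTablePair G' K') (e : G ≃* G') (f : K ≃* K') : IsTablePair G K := by
  rcases h with ⟨⟨a⟩, ⟨b⟩⟩ | ⟨⟨a⟩, ⟨b⟩⟩ | ⟨⟨a⟩, ⟨b⟩⟩ | ⟨⟨a⟩, ⟨b⟩⟩
  · exact .inl ⟨⟨e.trans a⟩, ⟨f.trans b⟩⟩
  · exact .inr (.inl ⟨⟨e.trans a⟩, ⟨f.trans b⟩⟩)
  · exact .inr (.inr (.inl ⟨⟨e.trans a⟩, ⟨f.trans b⟩⟩))
  · exact .inr (.inr (.inr ⟨⟨e.trans a⟩, ⟨f.trans b⟩⟩))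

theorem isTablePair_of_generatedByInvolutionsOutside (hG : Nat.card G = 16)
    (hna : ¬ ∀ a b : G, a * b = b * a) {H : Subgroup G} (hH : H.index = 2)
    (hgen : GeneratedByInvolutionsOutside H) : IsTablePair G H :=
  (isTable_of_closure_involutions hG hna _ (fun s hs => by
    rw [← sq, ← hs.2, pow_orderOf_eq_one]) hgen).2 H hH fun _ hs => hs.1

end Classification

/-! ### Telling the groups of the table apart, and tools for the converse -/

section Table

open DihedralGroup in
theorem isEmpty_dihedral_eight_of_pow_four {G : Type*} [Group G] (h : ∀ g : G, g ^ 4 = 1) :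
    IsEmpty (DihedralGroup 8 ≃* G) := by
  refine ⟨fun e => ?_⟩
  have : (r 1 : DihedralGroup 8) ^ 4 = 1 := e.injective (by rw [map_pow, h, map_one])
  exact absurd this (by decide)

theorem pow_four_cyc_two_prod_dihedral : ∀ g : Cyc 2 × DihedralGroup 4, g ^ 4 = 1 := by decide

theorem pow_four_C4CentralD4 (g : C4CentralD4) : g ^ 4 = 1 := by
  obtain ⟨p, rfl⟩ := QuotientGroup.mk_surjective g
  have h : ∀ p : Cyc 4 × DihedralGroup 4, p ^ 4 = 1 := by decide
  rw [← QuotientGroup.mk_pow, h, QuotientGroup.mk_one]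

/-- Turns membership in the amalgamated subgroup into equalities that `decide` can refute. -/
theorem eq_of_mem_amalgamatedCentre {p : Cyc 4 × DihedralGroup 4} (hp : p ∈ amalgamatedCentre) :
    p = 1 ∨ p = (Multiplicative.ofAdd (2 : ZMod 4), DihedralGroup.r (2 : ZMod 4)) := by
  obtain ⟨k, rfl⟩ := Subgroup.mem_zpowers_iff.mp hp
  generalize hz : ((Multiplicative.ofAdd (2 : ZMod 4), DihedralGroup.r (2 : ZMod 4)) :
    Cyc 4 × DihedralGroup 4) = z
  have hz2 : z * z = 1 := by rw [← hz]; decide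
  obtain ⟨l, rfl | rfl⟩ := Int.even_or_odd' k
  · left; rw [zpow_mul, zpow_two, hz2, one_zpow]
  · right; rw [zpow_add, zpow_mul, zpow_two, hz2, one_zpow, one_mul, zpow_one]

/-- The centres differ: that of C₂ × D₄ has exponent 2, while the generator of C₄ gives a central
element of order 4 in the central product. -/
theorem isEmpty_cyc_two_prod_dihedral_C4CentralD4 :
    IsEmpty ((Cyc 2 × DihedralGroup 4) ≃* C4CentralD4) := by
  refine ⟨fun e => ?_⟩
  let p : Cyc 4 × DihedralGroup 4 := (Multiplicative.ofAdd 1, 1)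
  have hp : ∀ q : Cyc 4 × DihedralGroup 4, p * q = q * p := by decide
  let u : C4CentralD4 := QuotientGroup.mk p
  have hu : ∀ g : C4CentralD4, u * g = g * u := by
    intro g
    obtain ⟨q, rfl⟩ := QuotientGroup.mk_surjective g
    rw [← QuotientGroup.mk_mul, hp, QuotientGroup.mk_mul]
  have hcentre : ∀ g : Cyc 2 × DihedralGroup 4, (∀ h, g * h = h * g) → g * g = 1 := by decide
  have hu2 : u * u = 1 := by
    have := hcentre (e.symm u) fun h => by
      apply e.injective
      rw [map_mul, map_mul, e.apply_symm_apply, hu]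
    rwa [← map_mul, map_eq_one_iff _ e.symm.injective] at this
  rw [← QuotientGroup.mk_mul, QuotientGroup.eq_one_iff] at hu2
  exact absurd (eq_of_mem_amalgamatedCentre hu2) (by decide)

theorem isEmpty_cyc_four_prod_cyc_two_dihedral :
    IsEmpty ((Cyc 4 × Cyc 2) ≃* DihedralGroup 4) := by
  refine ⟨fun e => ?_⟩
  have h : ∀ a b : DihedralGroup 4, a * b = b * a := fun a b => by
    apply e.symm.injective
    rw [map_mul, map_mul, mul_comm]
  exact absurd h (by decide)

/-- The kernel of a quadratic character taking the value `-1` on a generating set of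
involutions. -/
theorem exists_subgroup_of_character {G : Type*} [Group G] (χ : G →* ℤˣ) (S : Set G)
    (hgen : Subgroup.closure S = ⊤) (hne : S.Nonempty) (h2 : ∀ s ∈ S, orderOf s = 2)
    (hχ : ∀ s ∈ S, χ s = -1) : χ.ker.index = 2 ∧ GeneratedByInvolutionsOutside χ.ker := by
  constructor
  · obtain ⟨s, hs⟩ := hne
    have : χ.range = ⊤ := by
      rw [eq_top_iff]
      intro u _
      rcases Int.units_eq_one_or u with rfl | rfl
      · exact one_mem _
      · exact ⟨s, hχ s hs⟩
    rw [Subgroup.index_ker, this]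
    simp
  · refine top_le_iff.mp (hgen ▸ Subgroup.closure_mono fun s hs => ⟨?_, h2 s hs⟩)
    rw [MonoidHom.mem_ker, hχ s hs]
    decide

/-- `G` is a nonabelian group of order `16` with a subgroup of index `2` isomorphic to `K` and
generated by the involutions outside it. -/
def HasInvolutoryPair (G K : Type*) [Group G] [Group K] : Prop :=
  Nat.card G = 16 ∧ (¬ ∀ a b : G, a * b = b * a) ∧
    ∃ H : Subgroup G, H.index = 2 ∧ Nonempty (H ≃* K) ∧ GeneratedByInvolutionsOutside H

theorem HasInvolutoryPair.of_mulEquiv {G K G' K' : Type*} [Group G] [Group K] [Group G']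
    [Group K'] (h : HasInvolutoryPair G' K') (e : G ≃* G') (f : K ≃* K') :
    HasInvolutoryPair G K := by
  obtain ⟨h1, h2, H, h3, ⟨g⟩, h4⟩ := h
  refine ⟨(Nat.card_congr e.toEquiv).trans h1, fun hc => h2 fun a b => ?_,
    H.map e.symm.toMonoidHom, ?_, ⟨?_⟩, ?_⟩
  · apply e.symm.injective
    rw [map_mul, map_mul, hc]
  · rw [← h3]
    exact Subgroup.index_map_equiv H e.symm
  · exact ((H.equivMapOfInjective _ e.symm.injective).symm.trans g).trans f.symm
  · rw [GeneratedByInvolutionsOutside, eq_top_iff, ← Subgroup.map_top_of_surjective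
      e.symm.toMonoidHom e.symm.surjective, ← h4, MonoidHom.map_closure]
    refine Subgroup.closure_mono ?_
    rintro _ ⟨s, ⟨hs, hs2⟩, rfl⟩
    refine ⟨?_, ?_⟩
    · rintro ⟨t, ht, hts⟩
      exact hs (e.symm.injective hts ▸ ht)
    · rw [← hs2]
      exact MulEquiv.orderOf_eq e.symm s

theorem HasInvolutoryPair.isTablePair {G K : Type*} [Group G] [Group K]
    (h : HasInvolutoryPair G K) : IsTablePair G K := by
  obtain ⟨h1, h2, H, h3, ⟨g⟩, h4⟩ := h
  exact (isTablePair_of_generatedByInvolutionsOutside h1 h2 h3 h4).of_mulEquiv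
    (MulEquiv.refl G) g.symm

open DihedralGroup

/-- The character of `D_8` that is trivial exactly on the rotations. -/
def dihedralEightChar : DihedralGroup 8 →* ℤˣ :=
  MonoidHom.mk' (fun d => match d with | .r _ => 1 | .sr _ => -1) (by
    rintro (i | i) (j | j) <;> simp)

theorem hasInvolutoryPair_dihedral_eight : HasInvolutoryPair (DihedralGroup 8) (Cyc 8) := by
  obtain ⟨h1, h2⟩ := exists_subgroup_of_character dihedralEightChar {sr 0, sr 1}
    (by
      rw [eq_top_iff]
      have h : ∀ g : DihedralGroup 8, ∃ i : Fin 8, ∃ j : Fin 2,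
          g = (sr 0 * sr 1) ^ (i : ℕ) * (sr 0) ^ (j : ℕ) := by decide
      intro g _
      obtain ⟨i, j, rfl⟩ := h g
      have ha := Subgroup.subset_closure (G := DihedralGroup 8) (k := {sr 0, sr 1}) (.inl rfl)
      have hb := Subgroup.subset_closure (G := DihedralGroup 8) (k := {sr 0, sr 1}) (.inr rfl)
      exact mul_mem (pow_mem (mul_mem ha hb) _) (pow_mem ha _))
    ⟨_, .inl rfl⟩ (by rintro _ (rfl | rfl) <;> exact orderOf_sr _)
    (by rintro _ (rfl | rfl) <;> rfl)
  have hG : Nat.card (DihedralGroup 8) = 16 := nat_card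
  have hna : ¬ ∀ a b : DihedralGroup 8, a * b = b * a := by decide
  refine ⟨hG, hna, _, h1, ?_, h2⟩
  -- The kernel need not be computed: only one row of the table has this group as its first entry.
  rcases isTablePair_of_generatedByInvolutionsOutside hG hna h1 h2 with h | h | h | h
  · exact h.2
  · exact ((isEmpty_dihedral_eight_of_pow_four pow_four_cyc_two_prod_dihedral).false h.1.some).elim
  · exact ((isEmpty_dihedral_eight_of_pow_four pow_four_cyc_two_prod_dihedral).false h.1.some).elim
  · exact ((isEmpty_dihedral_eight_of_pow_four pow_four_C4CentralD4).false h.1.some).elim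

/-- The character of `C_n × D_4` (with `n` even) taking the value `ε` on the generator of `C_n`,
`1` on rotations and `-1` on reflections. -/
def cycDihedralChar (n : ℕ) (ε : ℤˣ) (hn : ε ^ n = 1) : Cyc n × DihedralGroup 4 →* ℤˣ :=
  (cycLift n ε hn).coprod
    (dihedralLift (n := 4) 1 (-1) (one_pow 4) (by decide) (by decide))

/-- The two choices of `c` serve the two rows with group C₂ × D₄: `c = 1` for the dihedral kernel,
`c = sr 0` for the abelian one. -/
theorem closure_cyc_two_prod_dihedral (c : DihedralGroup 4)
    (hc : c = 1 ∨ c = sr 0) :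
    Subgroup.closure {((1, sr 0) : Cyc 2 × DihedralGroup 4), (1, sr 1),
      (Multiplicative.ofAdd 1, c)} = ⊤ := by
  set S : Set (Cyc 2 × DihedralGroup 4) := {(1, sr 0), (1, sr 1), (Multiplicative.ofAdd 1, c)}
  have h : ∀ c : DihedralGroup 4, c = 1 ∨ c = sr 0 → ∀ g : Cyc 2 × DihedralGroup 4,
      ∃ i : Fin 4, ∃ j k : Fin 2, g = ((1, sr 0) * (1, sr 1)) ^ (i : ℕ) * (1, sr 0) ^ (j : ℕ) *
        (Multiplicative.ofAdd 1, c) ^ (k : ℕ) := by decide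
  rw [eq_top_iff]
  intro g _
  obtain ⟨i, j, k, rfl⟩ := h c hc g
  have ha : (1, sr 0) ∈ Subgroup.closure S := Subgroup.subset_closure (.inl rfl)
  have hb : (1, sr 1) ∈ Subgroup.closure S := Subgroup.subset_closure (.inr (.inl rfl))
  have hc : (Multiplicative.ofAdd 1, c) ∈ Subgroup.closure S :=
    Subgroup.subset_closure (.inr (.inr rfl))
  exact mul_mem (mul_mem (pow_mem (mul_mem ha hb) _) (pow_mem ha _)) (pow_mem hc _)

end Table

/-! ### Every pair of the table occurs -/

section TableConverse

open DihedralGroup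

theorem cycDihedralChar_ofAdd_one {n : ℕ} {ε : ℤˣ} (hn : ε ^ n = 1) (d : DihedralGroup 4) :
    cycDihedralChar n ε hn (Multiplicative.ofAdd 1, d) = ε * cycDihedralChar n ε hn (1, d) := by
  simp [cycDihedralChar, cycLift_one]

theorem cycDihedralChar_one_r {n : ℕ} {ε : ℤˣ} (hn : ε ^ n = 1) (i : ZMod 4) :
    cycDihedralChar n ε hn (1, r i) = 1 := by
  obtain ⟨k, -, hk⟩ := exists_cycLift_eq_zpow (one_pow 4 : (1 : ℤˣ) ^ 4 = 1) (Multiplicative.ofAdd i)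
  rw [one_zpow] at hk
  rw [cycDihedralChar, MonoidHom.coprod_apply, map_one, one_mul]
  exact hk

theorem cycDihedralChar_one_sr {n : ℕ} {ε : ℤˣ} (hn : ε ^ n = 1) (i : ZMod 4) :
    cycDihedralChar n ε hn (1, sr i) = -1 := by
  have : ((1 : Cyc n), (sr i : DihedralGroup 4)) = (1, sr 0) * (1, r i) := by simp
  rw [this, map_mul, cycDihedralChar_one_r, mul_one]
  change cycLift n ε hn 1 * (-1 * cycLift 4 1 _ 1) = -1
  rw [map_one, map_one, one_mul, mul_one]

theorem nonabelian_cyc_two_prod_dihedral :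
    ¬ ∀ a b : Cyc 2 × DihedralGroup 4, a * b = b * a := by decide

theorem card_cyc_two_prod_dihedral : Nat.card (Cyc 2 × DihedralGroup 4) = 16 := by
  rw [Nat.card_prod, card_cyc, nat_card]

theorem cyc_two_prod_dihedral_table {K : Type*} [Group K]
    (h : IsTablePair (Cyc 2 × DihedralGroup 4) K) :
    Nonempty (K ≃* (Cyc 4 × Cyc 2)) ∨ Nonempty (K ≃* DihedralGroup 4) := by
  rcases h with h | h | h | h
  · exact ((isEmpty_dihedral_eight_of_pow_four
      pow_four_cyc_two_prod_dihedral).false h.1.some.symm).elim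
  · exact .inl h.2
  · exact .inr h.2
  · exact (isEmpty_cyc_two_prod_dihedral_C4CentralD4.false h.1.some).elim

theorem hasInvolutoryPair_cyc_two_prod_dihedral_dihedral :
    HasInvolutoryPair (Cyc 2 × DihedralGroup 4) (DihedralGroup 4) := by
  have hε : (-1 : ℤˣ) ^ 2 = 1 := by decide
  obtain ⟨h1, h2⟩ := exists_subgroup_of_character (cycDihedralChar 2 (-1) hε) _
    (closure_cyc_two_prod_dihedral 1 (.inl rfl)) ⟨_, .inl rfl⟩
    (by rintro _ (rfl | rfl | rfl) <;> exact orderOf_eq_prime (by decide) (by decide))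
    (by
      rintro _ (rfl | rfl | rfl)
      · exact cycDihedralChar_one_sr _ _
      · exact cycDihedralChar_one_sr _ _
      · rw [cycDihedralChar_ofAdd_one]
        exact (congrArg _ (map_one _)).trans (mul_one _))
  refine ⟨card_cyc_two_prod_dihedral, nonabelian_cyc_two_prod_dihedral, _, h1, ?_, h2⟩
  refine (cyc_two_prod_dihedral_table (isTablePair_of_generatedByInvolutionsOutside
    card_cyc_two_prod_dihedral nonabelian_cyc_two_prod_dihedral h1 h2)).resolve_left ?_
  -- Two noncommuting elements of the kernel exclude the abelian row.
  rintro ⟨e⟩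
  let g : (cycDihedralChar 2 (-1) hε).ker := ⟨(1, r 1), cycDihedralChar_one_r _ _⟩
  let h : (cycDihedralChar 2 (-1) hε).ker := ⟨(Multiplicative.ofAdd 1, sr 0), by
    rw [MonoidHom.mem_ker, cycDihedralChar_ofAdd_one, cycDihedralChar_one_sr]; decide⟩
  have hgh : g * h = h * g := e.injective (by rw [map_mul, map_mul, mul_comm])
  have hne : ((1, r 1) : Cyc 2 × DihedralGroup 4) * (Multiplicative.ofAdd 1, sr 0) ≠
      (Multiplicative.ofAdd 1, sr 0) * (1, r 1) := by decide
  exact hne (congrArg Subtype.val hgh)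

theorem hasInvolutoryPair_cyc_two_prod_dihedral_cyc :
    HasInvolutoryPair (Cyc 2 × DihedralGroup 4) (Cyc 4 × Cyc 2) := by
  have hε : (1 : ℤˣ) ^ 2 = 1 := by decide
  obtain ⟨h1, h2⟩ := exists_subgroup_of_character (cycDihedralChar 2 1 hε) _
    (closure_cyc_two_prod_dihedral (sr 0) (.inr rfl)) ⟨_, .inl rfl⟩
    (by rintro _ (rfl | rfl | rfl) <;> exact orderOf_eq_prime (by decide) (by decide))
    (by
      rintro _ (rfl | rfl | rfl)
      · exact cycDihedralChar_one_sr _ _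
      · exact cycDihedralChar_one_sr _ _
      · rw [cycDihedralChar_ofAdd_one, cycDihedralChar_one_sr]; decide)
  refine ⟨card_cyc_two_prod_dihedral, nonabelian_cyc_two_prod_dihedral, _, h1, ?_, h2⟩
  refine (cyc_two_prod_dihedral_table (isTablePair_of_generatedByInvolutionsOutside
    card_cyc_two_prod_dihedral nonabelian_cyc_two_prod_dihedral h1 h2)).resolve_right ?_
  rintro ⟨e⟩
  -- This character ignores the C₂ factor, so the kernel involves only rotations and is abelian,
  -- which excludes the row with D₄.
  have hr : ∀ g ∈ (cycDihedralChar 2 1 hε).ker, ∃ i, g.2 = r i := by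
    rintro ⟨a, i | i⟩ hg
    · exact ⟨i, rfl⟩
    · have : (a, (sr i : DihedralGroup 4)) = (a, 1) * (1, sr i) := by simp
      obtain ⟨k, -, hk⟩ := exists_cycLift_eq_zpow hε a
      rw [MonoidHom.mem_ker, this, map_mul, cycDihedralChar_one_sr, cycDihedralChar,
        MonoidHom.coprod_apply, map_one, hk, one_zpow] at hg
      exact absurd hg (by decide)
  have hcomm : ∀ a b : (cycDihedralChar 2 1 hε).ker, a * b = b * a := by
    rintro ⟨a, ha⟩ ⟨b, hb⟩
    obtain ⟨i, hi⟩ := hr a ha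
    obtain ⟨j, hj⟩ := hr b hb
    refine Subtype.ext (Prod.ext (mul_comm _ _) ?_)
    change a.2 * b.2 = b.2 * a.2
    rw [hi, hj, r_mul_r, r_mul_r, add_comm]
  have : ∀ a b : DihedralGroup 4, a * b = b * a := fun a b =>
    e.symm.injective (by rw [map_mul, map_mul, hcomm])
  exact absurd this (by decide)

theorem hasInvolutoryPair_C4CentralD4 : HasInvolutoryPair C4CentralD4 (QuaternionGroup 2) := by
  have hε : (-1 : ℤˣ) ^ 4 = 1 := by decide
  have hχ : amalgamatedCentre ≤ (cycDihedralChar 4 (-1) hε).ker := by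
    rw [Subgroup.zpowers_le, MonoidHom.mem_ker]
    have : (Multiplicative.ofAdd (2 : ZMod 4), r (2 : ZMod 4)) =
        ((Multiplicative.ofAdd 1, r 1) : Cyc 4 × DihedralGroup 4) * (Multiplicative.ofAdd 1, r 1) := by
      decide
    rw [this, map_mul, cycDihedralChar_ofAdd_one, cycDihedralChar_one_r]
    decide
  let π : Cyc 4 × DihedralGroup 4 →* C4CentralD4 := QuotientGroup.mk' amalgamatedCentre
  -- The third generator has order 4, but its square is the generator of `amalgamatedCentre`, so its
  -- image is an involution.
  let T : Set (Cyc 4 × DihedralGroup 4) := {(1, sr 0), (1, sr 1), (Multiplicative.ofAdd 1, r 1)}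
  have hT : Subgroup.closure T = ⊤ := by
    have h : ∀ g : Cyc 4 × DihedralGroup 4, ∃ i : Fin 4, ∃ j : Fin 2, ∃ k : Fin 4,
        g = ((1, sr 0) * (1, sr 1)) ^ (i : ℕ) * (1, sr 0) ^ (j : ℕ) *
          (Multiplicative.ofAdd 1, r 1) ^ (k : ℕ) := by decide +kernel
    rw [eq_top_iff]
    intro g _
    obtain ⟨i, j, k, rfl⟩ := h g
    have ha : (1, sr 0) ∈ Subgroup.closure T := Subgroup.subset_closure (.inl rfl)
    have hb : (1, sr 1) ∈ Subgroup.closure T := Subgroup.subset_closure (.inr (.inl rfl))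
    have hc : (Multiplicative.ofAdd 1, r 1) ∈ Subgroup.closure T :=
      Subgroup.subset_closure (.inr (.inr rfl))
    exact mul_mem (mul_mem (pow_mem (mul_mem ha hb) _) (pow_mem ha _)) (pow_mem hc _)
  let χ : C4CentralD4 →* ℤˣ := QuotientGroup.lift amalgamatedCentre (cycDihedralChar 4 (-1) hε) hχ
  have hval : ∀ s ∈ π '' T, χ s = -1 := by
    rintro _ ⟨_, rfl | rfl | rfl, rfl⟩
    · exact cycDihedralChar_one_sr hε _
    · exact cycDihedralChar_one_sr hε _
    · exact (cycDihedralChar_ofAdd_one hε _).trans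
        ((congrArg _ (cycDihedralChar_one_r hε _)).trans (mul_one _))
  obtain ⟨h1, h2⟩ := exists_subgroup_of_character χ (π '' T)
    (by rw [← MonoidHom.map_closure, hT, Subgroup.map_top_of_surjective π
      (QuotientGroup.mk'_surjective _)])
    ⟨_, _, .inl rfl, rfl⟩
    (by
      intro s hs
      have hs1 : s ≠ 1 := by
        rintro rfl
        exact absurd ((map_one χ).symm.trans (hval 1 hs)) (by decide)
      refine orderOf_eq_prime ?_ hs1
      obtain ⟨p, hp, rfl⟩ := hs
      have h0 : p ^ 2 = 1 ∨ p ^ 2 = (Multiplicative.ofAdd (2 : ZMod 4), r (2 : ZMod 4)) := by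
        rcases hp with rfl | rfl | rfl <;> decide
      rw [← map_pow]
      rcases h0 with h0 | h0 <;> rw [h0]
      · exact map_one π
      · exact (QuotientGroup.eq_one_iff _).mpr (Subgroup.mem_zpowers _))
    hval
  have hna : ¬ ∀ a b : C4CentralD4, a * b = b * a := by
    intro hcomm
    have h := hcomm (π (1, r 1)) (π (1, sr 0))
    rw [← map_mul, ← map_mul] at h
    exact absurd (eq_of_mem_amalgamatedCentre (QuotientGroup.eq.mp h)) (by decide)
  refine ⟨card_C4CentralD4, hna, _, h1, ?_, h2⟩
  rcases isTablePair_of_generatedByInvolutionsOutside card_C4CentralD4 hna h1 h2 with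
    h | h | h | h
  · exact ((isEmpty_dihedral_eight_of_pow_four pow_four_C4CentralD4).false h.1.some.symm).elim
  · exact (isEmpty_cyc_two_prod_dihedral_C4CentralD4.false h.1.some.symm).elim
  · exact (isEmpty_cyc_two_prod_dihedral_C4CentralD4.false h.1.some.symm).elim
  · exact h.2

theorem hasInvolutoryPair_iff_isTablePair {G K : Type*} [Group G] [Group K] :
    HasInvolutoryPair G K ↔ IsTablePair G K := by
  refine ⟨HasInvolutoryPair.isTablePair, ?_⟩
  rintro (⟨⟨e⟩, ⟨f⟩⟩ | ⟨⟨e⟩, ⟨f⟩⟩ | ⟨⟨e⟩, ⟨f⟩⟩ | ⟨⟨e⟩, ⟨f⟩⟩)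
  · exact hasInvolutoryPair_dihedral_eight.of_mulEquiv e f
  · exact hasInvolutoryPair_cyc_two_prod_dihedral_cyc.of_mulEquiv e f
  · exact hasInvolutoryPair_cyc_two_prod_dihedral_dihedral.of_mulEquiv e f
  · exact hasInvolutoryPair_C4CentralD4.of_mulEquiv e f

end TableConverse

/-! ### Inertia groups, stabilizers of infinite places and unramified fixed fields -/

section Ramification

open NumberField Ideal Pointwise

theorem card_inertia_eq_ramificationIdx {E L G : Type*} [Field E] [NumberField E] [Field L]
    [NumberField L] [Algebra E L] [Group G] [Finite G] [MulSemiringAction G L]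
    [IsGaloisGroup G E L] (P : Ideal (𝓞 L)) [P.IsPrime] :
    Nat.card (P.toAddSubgroup.inertia G) = P.ramificationIdx (𝓞 E) := by
  have := IsGaloisGroup.of_isFractionRing G (𝓞 E) (𝓞 L) E L
  rw [card_inertia_eq_ramificationIdxIn (P.under (𝓞 E)) P,
    ramificationIdxIn_eq_ramificationIdx (P.under (𝓞 E)) P G]

variable {F L : Type*} [Field F] [NumberField F] [Field L] [NumberField L] [Algebra F L]
  [IsGalois F L]

omit [IsGalois F L] in
theorem card_subgroup_inertia_eq_ramificationIdx (N : Subgroup Gal(L/F))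
    (E : IntermediateField F L) [IsGaloisGroup N E L] (P : Ideal (𝓞 L)) [P.IsPrime] :
    Nat.card (P.toAddSubgroup.inertia Gal(L/F) ⊓ N : Subgroup Gal(L/F)) =
      P.ramificationIdx (𝓞 E) := by
  have h := card_inertia_eq_ramificationIdx (E := E) (G := N) P
  rw [← h, ← AddSubgroup.inertia_map_subtype]
  exact (Nat.card_congr (Subgroup.equivMapOfInjective _ _ N.subtype_injective).toEquiv).symm

/-- Ramification indices multiply in the tower through the fixed field of `N`. Those of `P` over `F`
and over the fixed field are the orders of the inertia group and of its intersection with `N`; these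
agree, so the bottom index is 1. -/
theorem isUnramifiedAt_of_inertia_le (N : Subgroup Gal(L/F)) (P : Ideal (𝓞 L)) [P.IsPrime]
    (hN : P.toAddSubgroup.inertia Gal(L/F) ≤ N)
    (Q : Ideal (𝓞 (IntermediateField.fixedField N))) [Q.IsPrime]
    [P.LiesOver Q] : Algebra.IsUnramifiedAt (𝓞 F) Q := by
  have : IsGaloisGroup N (IntermediateField.fixedField N) L :=
    IsGaloisGroup.subgroup Gal(L/F) F L N
  have h1 := card_inertia_eq_ramificationIdx (E := F) (G := Gal(L/F)) P
  have h2 := card_subgroup_inertia_eq_ramificationIdx N (IntermediateField.fixedField N) P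
  have h4 := ramificationIdx_tower (R := 𝓞 F) Q P
  rw [← h1, ← h2, inf_eq_left.mpr hN] at h4
  have : Nat.card (P.toAddSubgroup.inertia Gal(L/F)) ≠ 0 := Nat.card_pos.ne'
  rw [← ramificationIdx_eq_one_iff]
  exact (right_eq_mul₀ this).mp h4

theorem inertia_inf_fixingSubgroup_eq_bot (k : IntermediateField F L)
    (P : Ideal (𝓞 L)) [P.IsPrime] (h : Algebra.IsUnramifiedAt (𝓞 k) P) :
    P.toAddSubgroup.inertia Gal(L/F) ⊓ k.fixingSubgroup = ⊥ := by
  have : IsGaloisGroup k.fixingSubgroup k L := IsGaloisGroup.intermediateField Gal(L/F) F L k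
  have h1 := card_subgroup_inertia_eq_ramificationIdx k.fixingSubgroup k P
  rwa [ramificationIdx_eq_one, Subgroup.card_eq_one] at h1

omit [NumberField F] [NumberField L] [IsGalois F L] in
theorem exists_restrictScalars_eq_of_mem_fixingSubgroup (k : IntermediateField F L)
    {σ : Gal(L/F)} (hσ : σ ∈ k.fixingSubgroup) : ∃ τ : Gal(L/k), ∀ x, τ x = σ x :=
  ⟨IntermediateField.fixingSubgroupEquiv k ⟨σ, hσ⟩, fun _ => rfl⟩

omit [NumberField F] [NumberField L] [IsGalois F L] in
theorem eq_one_of_mem_stabilizer_of_isUnramified (k : IntermediateField F L)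
    (w : InfinitePlace L) (h : w.IsUnramified k) {σ : Gal(L/F)} (hσ : σ ∈ k.fixingSubgroup)
    (hw : σ • w = w) : σ = 1 := by
  obtain ⟨τ, hτ⟩ := exists_restrictScalars_eq_of_mem_fixingSubgroup k hσ
  have hτw : τ ∈ MulAction.stabilizer Gal(L/k) w := by
    rw [MulAction.mem_stabilizer_iff]
    ext x
    obtain ⟨y, rfl⟩ := τ.surjective x
    have := DFunLike.congr_fun hw (σ y)
    simp only [InfinitePlace.smul_apply, AlgEquiv.symm_apply_apply] at this ⊢
    rw [this, hτ]
  rw [h.stabilizer_eq_bot, Subgroup.mem_bot] at hτw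
  ext x
  rw [← hτ, hτw]
  rfl

/-- If the restriction of `w` ramified, it would be complex, so `w` would be unramified over the
fixed field but ramified over `F`. A nontrivial element of its stabilizer would then lie in `N`,
contradicting the former. -/
theorem isUnramified_comap_of_stabilizer_le (N : Subgroup Gal(L/F)) (w : InfinitePlace L)
    (hN : MulAction.stabilizer Gal(L/F) w ≤ N) :
    (w.comap (algebraMap (IntermediateField.fixedField N) L)).IsUnramified F := by
  by_contra hv
  rw [InfinitePlace.not_isUnramified_iff] at hv
  have hwc : w.IsComplex := hv.1.of_comap
  have hw : ¬ w.IsUnramified F := InfinitePlace.not_isUnramified_iff.mpr ⟨hwc, hv.2⟩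
  rw [InfinitePlace.isUnramified_iff_stabilizer_eq_bot, Subgroup.eq_bot_iff_forall] at hw
  push Not at hw
  obtain ⟨σ, hσ, hσ1⟩ := hw
  refine hσ1 (eq_one_of_mem_stabilizer_of_isUnramified (IntermediateField.fixedField N) w
    ?_ ?_ hσ)
  · exact InfinitePlace.isUnramified_iff.mpr (.inr hv.1)
  · rw [IntermediateField.fixingSubgroup_fixedField]
    exact hN hσ

/-- A proper subgroup of a group of order `2 ^ n` lies in a subgroup of index `2`. -/
theorem Subgroup.exists_le_index_eq_two {G : Type*} [Group G] {n : ℕ} (hG : Nat.card G = 2 ^ n)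
    {N : Subgroup G} (hN : N ≠ ⊤) : ∃ M : Subgroup G, N ≤ M ∧ M.index = 2 := by
  have : Finite G := Nat.finite_of_card_ne_zero (by rw [hG]; positivity)
  obtain ⟨m, hm, hNm⟩ := (Nat.dvd_prime_pow Nat.prime_two).mp (hG ▸ N.card_subgroup_dvd_card)
  have hmn : m ≠ n := fun h => hN (Subgroup.eq_top_of_card_eq N (by rw [hNm, hG, h]))
  obtain ⟨k, rfl⟩ : ∃ k, n = k + 1 := ⟨n - 1, by omega⟩
  obtain ⟨M, hM, hNM⟩ := Sylow.exists_subgroup_card_pow_prime_le 2 (m := k)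
    (hG ▸ pow_dvd_pow 2 k.le_succ) N hNm (by omega)
  refine ⟨M, hNM, ?_⟩
  have := M.card_mul_index
  rw [hM, hG, pow_succ] at this
  exact Nat.eq_of_mul_eq_mul_left (by positivity) this

/-- If a subgroup of a Galois `2`-group contains all inertia groups, finite and infinite, then it
is everything, or the base field has an everywhere unramified quadratic extension. -/
theorem eq_top_or_exists_unramified_quadratic {n : ℕ} (hn : Module.finrank F L = 2 ^ n)
    (N : Subgroup Gal(L/F))
    (hfin : ∀ (P : Ideal (𝓞 L)) [P.IsPrime], P ≠ ⊥ → P.toAddSubgroup.inertia Gal(L/F) ≤ N)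
    (hinf : ∀ w : InfinitePlace L, MulAction.stabilizer Gal(L/F) w ≤ N) :
    N = ⊤ ∨ ∃ K : IntermediateField F L, Module.finrank F K = 2 ∧
      UnramifiedAtFinitePrimes F K ∧ IsUnramifiedAtInfinitePlaces F K := by
  refine or_iff_not_imp_left.mpr fun hN => ?_
  obtain ⟨M, hNM, hM⟩ := Subgroup.exists_le_index_eq_two
    ((IsGalois.card_aut_eq_finrank F L).trans hn) hN
  refine ⟨IntermediateField.fixedField M, ?_, ?_, ⟨fun v => ?_⟩⟩
  · rw [IntermediateField.finrank_eq_fixingSubgroup_index,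
      IntermediateField.fixingSubgroup_fixedField, hM]
  · intro Q hQ hQ0
    obtain ⟨⟨P, hP, hPQ⟩⟩ := (inferInstance : Nonempty (Q.primesOver (𝓞 L)))
    have hP0 : P ≠ ⊥ := Ideal.ne_bot_of_liesOver_of_ne_bot hQ0 P
    exact isUnramifiedAt_of_inertia_le M P ((hfin P hP0).trans hNM) Q
  · obtain ⟨w, rfl⟩ := InfinitePlace.comap_surjective (K := L) v
    exact isUnramified_comap_of_stabilizer_le M w ((hinf w).trans hNM)

end Ramification

/-! ### An index count for involutions on finitely generated abelian groups -/

section UnitIndex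

open Module

theorem AddMonoidHom.index_range_eq_card_ker {T : Type*} [AddCommGroup T] [Finite T]
    (f : T →+ T) : f.range.index = Nat.card f.ker := by
  have h1 := f.range.card_mul_index
  have h2 := f.ker.card_mul_index
  rw [AddSubgroup.index_ker, mul_comm, ← h1] at h2
  exact (Nat.eq_of_mul_eq_mul_left Nat.card_pos h2).symm

theorem index_range_two_nsmul_pi_int (n : ℕ) :
    (nsmulAddMonoidHom (α := Fin n → ℤ) 2).range.index = 2 ^ n := by
  let f : (Fin n → ℤ) →+ (Fin n → ZMod 2) := (Int.castAddHom (ZMod 2)).compLeft (Fin n)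
  have hf : f.ker = (nsmulAddMonoidHom (α := Fin n → ℤ) 2).range := by
    ext x
    constructor
    · intro hx
      have : ∀ i, ∃ y, x i = y + y := fun i => by
        have hi : ((x i : ℤ) : ZMod 2) = 0 := congrFun hx i
        exact (ZMod.intCast_zmod_eq_zero_iff_dvd _ 2).mp hi |>.elim fun y hy =>
          ⟨y, by push_cast at hy; omega⟩
      choose y hy using this
      exact ⟨y, funext fun i => by simp [hy, two_mul]⟩
    · rintro ⟨y, rfl⟩
      refine funext fun i => ?_
      change (((2 • y) i : ℤ) : ZMod 2) = 0
      rw [ZMod.intCast_zmod_eq_zero_iff_dvd]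
      simp
  have hs : Function.Surjective f := fun x => by
    choose y hy using fun i => ZMod.intCast_surjective (x i)
    exact ⟨y, funext hy⟩
  rw [← hf, AddSubgroup.index_ker, AddMonoidHom.range_eq_top.mpr hs]
  simp

theorem index_range_two_nsmul_prod (A B : Type*) [AddCommGroup A] [AddCommGroup B] :
    (nsmulAddMonoidHom (α := A × B) 2).range.index =
      (nsmulAddMonoidHom (α := A) 2).range.index * (nsmulAddMonoidHom (α := B) 2).range.index := by
  rw [← AddSubgroup.index_prod]
  congr 1
  ext ⟨a, b⟩
  simp [AddSubgroup.mem_prod, Prod.ext_iff]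

theorem index_range_two_nsmul_congr {A B : Type*} [AddCommGroup A] [AddCommGroup B] (e : A ≃+ B) :
    (nsmulAddMonoidHom (α := A) 2).range.index = (nsmulAddMonoidHom (α := B) 2).range.index := by
  rw [← AddSubgroup.index_map_equiv _ e]
  congr 1
  ext b
  constructor
  · rintro ⟨_, ⟨a, rfl⟩, rfl⟩
    exact ⟨e a, (map_nsmul e 2 a).symm⟩
  · rintro ⟨b, rfl⟩
    exact ⟨2 • e.symm b, ⟨e.symm b, rfl⟩, by simp⟩

theorem finrank_range_add_finrank_ker_int {A B : Type*} [AddCommGroup A] [AddCommGroup B]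
    [Module.Finite ℤ A] (f : A →ₗ[ℤ] B) :
    finrank ℤ (LinearMap.range f) + finrank ℤ (LinearMap.ker f) = finrank ℤ A := by
  rw [← f.quotKerEquivRange.finrank_eq]
  exact Submodule.finrank_quotient_add_finrank _

theorem finrank_int_prod_of_finite (n : ℕ) (T : Type*) [AddCommGroup T] [_root_.Finite T] :
    finrank ℤ ((Fin n → ℤ) × T) = n := by
  have h := finrank_range_add_finrank_ker_int (LinearMap.fst ℤ (Fin n → ℤ) T)
  have h0 : finrank ℤ (LinearMap.ker (LinearMap.fst ℤ (Fin n → ℤ) T)) = 0 := by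
    rw [Module.finrank_eq_zero_iff_isTorsion]
    rintro ⟨⟨x, t⟩, hx⟩
    obtain rfl : x = 0 := hx
    refine ⟨⟨Nat.card T, mem_nonZeroDivisors_of_ne_zero (by exact_mod_cast Nat.card_pos.ne')⟩, ?_⟩
    apply Subtype.ext
    change ((Nat.card T : ℤ) • ((0 : Fin n → ℤ), t)) = 0
    rw [Prod.smul_mk, smul_zero, natCast_zsmul, card_nsmul_eq_zero']
    rfl
  rw [h0, add_zero, LinearMap.range_eq_top.mpr LinearMap.fst_surjective, finrank_top] at h
  rw [← h]
  simp

/-- The index of the doubles in a finitely generated abelian group. -/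
theorem index_range_two_nsmul (M : Type*) [AddCommGroup M] [Module.Finite ℤ M] :
    (nsmulAddMonoidHom (α := M) 2).range.index =
      2 ^ finrank ℤ M * Nat.card {x : M // 2 • x = 0} := by
  classical
  have : AddGroup.FG M := Module.Finite.iff_addGroup_fg.mp inferInstance
  -- The free part contributes `2 ^ n` and no 2-torsion; on the finite part, doubling has index
  -- equal to the order of its kernel.
  obtain ⟨n, ι, _, p, hp, e, ⟨f⟩⟩ := AddCommGroup.equiv_free_prod_directSum_zmod M
  have : ∀ i, NeZero (p i ^ e i) := fun i => ⟨pow_ne_zero _ (hp i).ne_zero⟩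
  let g : M ≃+ (Fin n → ℤ) × (∀ i, ZMod (p i ^ e i)) :=
    f.trans ((Finsupp.linearEquivFunOnFinite ℤ ℤ (Fin n)).toAddEquiv.prodCongr
      (DirectSum.addEquivProd _))
  rw [index_range_two_nsmul_congr g, index_range_two_nsmul_prod, index_range_two_nsmul_pi_int,
    AddMonoidHom.index_range_eq_card_ker, g.toIntLinearEquiv.finrank_eq, finrank_int_prod_of_finite]
  congr 1
  refine Nat.card_congr
    { toFun := fun t => ⟨g.symm (0, t.1), ?_⟩
      invFun := fun x => ⟨(g x.1).2, ?_⟩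
      left_inv := fun t => by simp
      right_inv := fun x => ?_ }
  · have ht : 2 • t.1 = 0 := t.2
    rw [← map_nsmul, Prod.smul_mk, smul_zero, ht]
    exact map_zero g.symm
  · have := congrArg Prod.snd (congrArg g x.2)
    rwa [map_nsmul, map_zero] at this
  · have h0 : (g x.1).1 = 0 := by
      have := congrArg Prod.fst (congrArg g x.2)
      rw [map_nsmul, map_zero, Prod.smul_fst, Prod.fst_zero] at this
      exact (smul_eq_zero.mp this).resolve_left two_ne_zero
    apply Subtype.ext
    change g.symm (0, (g x.1).2) = x.1
    rw [g.symm_apply_eq, ← h0]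

/-- A form of the inequality `|H¹| > 1` for the units of a quadratic extension: an involution `σ`
on a finitely generated group of rank `2 r + 1` with fixed part of rank `r`, both with exactly one
element of order `2`, has an element negated by `σ` that is not of the form `σ y - y`. -/
theorem exists_map_eq_neg_and_forall_ne {E : Type*} [AddCommGroup E] [Module.Finite ℤ E]
    (σ : E →ₗ[ℤ] E) (hσ : ∀ x, σ (σ x) = x) {r : ℕ} (hE : finrank ℤ E = 2 * r + 1)
    (hA : finrank ℤ (LinearMap.ker (σ - LinearMap.id)) = r) {e : E} (he0 : e ≠ 0)
    (he : ∀ x : E, 2 • x = 0 ↔ x = 0 ∨ x = e) (hσe : σ e = e) :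
    ∃ x, σ x = -x ∧ ∀ y, σ y - y ≠ x := by
  set A := LinearMap.ker (σ - LinearMap.id) with hAdef
  set B := LinearMap.ker (σ + LinearMap.id) with hBdef
  have hAmem : ∀ x, x ∈ A ↔ σ x = x := fun x => by
    rw [hAdef, LinearMap.mem_ker, LinearMap.sub_apply, sub_eq_zero]; rfl
  have hBmem : ∀ x, x ∈ B ↔ σ x = -x := fun x => by
    rw [hBdef, LinearMap.mem_ker, LinearMap.add_apply, add_eq_zero_iff_eq_neg]; rfl
  have he2 : 2 • e = 0 := (he e).mpr (.inr rfl)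
  by_contra! hcon
  let N : E →+ A := ((σ + LinearMap.id).codRestrict A fun x => by
    rw [hAmem]; simp [hσ, add_comm]).toAddMonoidHom
  let d : E →+ B := ((σ - LinearMap.id).codRestrict B fun x => by
    rw [hBmem]; simp [hσ]).toAddMonoidHom
  have hNval : ∀ x, (N x : E) = σ x + x := fun _ => rfl
  have hdval : ∀ x, (d x : E) = σ x - x := fun _ => rfl
  have hd : Function.Surjective d := fun b => by
    obtain ⟨y, hy⟩ := hcon b ((hBmem _).mp b.2)
    exact ⟨y, Subtype.ext hy⟩
  -- If `σ x + x = 2 a` with `a` fixed, then `a - x` is negated by `σ` and `σ x - x = 2 (a - x)`. As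
  -- `d` is onto by assumption, the index of `2 B` in `B` divides that of `2 A` in `A`, although `B`
  -- has larger rank and the same 2-torsion.
  have hle : (nsmulAddMonoidHom (α := A) 2).range.comap N ≤
      (nsmulAddMonoidHom (α := B) 2).range.comap d := by
    rintro x ⟨a, ha⟩
    have ha' : a.1 + a.1 = σ x + x := by
      rw [← hNval, ← ha, nsmulAddMonoidHom_apply, two_nsmul]; rfl
    have hσa : σ a.1 = a.1 := (hAmem _).mp a.2
    have hb : a.1 - x ∈ B := by
      rw [hBmem, map_sub, hσa, neg_sub, sub_eq_sub_iff_add_eq_add, ha', add_comm]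
    refine ⟨⟨a.1 - x, hb⟩, Subtype.ext ?_⟩
    rw [hdval, nsmulAddMonoidHom_apply, two_nsmul]
    change a.1 - x + (a.1 - x) = σ x - x
    rw [sub_add_sub_comm, ha', add_sub_add_right_eq_sub]
  have hAi := index_range_two_nsmul A
  have hBi := index_range_two_nsmul B
  have hcard : ∀ C : Submodule ℤ E, e ∈ C → Nat.card {x : C // 2 • x = 0} = 2 := by
    intro C heC
    have hmem : ∀ x : ({0, e} : Set E), x.1 ∈ C := by
      rintro ⟨x, rfl | rfl⟩
      · exact C.zero_mem
      · exact heC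
    exact (Nat.card_congr (β := ({0, e} : Set E))
      { toFun := fun x => ⟨x.1.1, (he _).mp (congrArg Subtype.val x.2)⟩
        invFun := fun x => ⟨⟨x.1, hmem x⟩, Subtype.ext ((he _).mpr x.2)⟩
        left_inv := fun _ => rfl
        right_inv := fun _ => rfl }).trans
      ((Nat.card_coe_set_eq _).trans (Set.ncard_pair he0.symm))
  rw [hcard A ((hAmem e).mpr hσe)] at hAi
  rw [hcard B ((hBmem e).mpr (by rw [hσe, eq_neg_iff_add_eq_zero, ← two_nsmul, he2]))] at hBi
  -- `B` is the kernel of `σ + 1`, whose image lies in `A`: its rank is at least `(2 r + 1) - r`.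
  have hrank : r + 1 ≤ finrank ℤ B := by
    have h1 : _ + finrank ℤ B = _ := finrank_range_add_finrank_ker_int (σ + LinearMap.id)
    have h2 : finrank ℤ (LinearMap.range (σ + LinearMap.id)) ≤ finrank ℤ A := by
      apply Submodule.finrank_mono
      rintro _ ⟨x, rfl⟩
      exact (N x).2
    omega
  have hindex : (nsmulAddMonoidHom (α := B) 2).range.index ≤
      (nsmulAddMonoidHom (α := A) 2).range.index := by
    rw [← AddSubgroup.index_comap_of_surjective _ hd]
    have hA0 : (nsmulAddMonoidHom (α := A) 2).range.index ≠ 0 := by rw [hAi]; positivity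
    have hdvd : ((nsmulAddMonoidHom (α := A) 2).range.comap N).index ∣
        (nsmulAddMonoidHom (α := A) 2).range.index := by
      rw [AddSubgroup.index_comap]
      exact AddSubgroup.relIndex_dvd_index_of_normal _ _
    exact Nat.le_of_dvd (Nat.pos_of_ne_zero hA0)
      ((AddSubgroup.index_dvd_of_le hle).trans hdvd)
  rw [hAi, hBi, hA, Nat.mul_le_mul_right_iff two_pos, Nat.pow_le_pow_iff_right one_lt_two] at hindex
  omega

end UnitIndex

/-! ### Invariant ideals in unramified extensions -/

section InvariantIdeals

open NumberField Ideal Pointwise UniqueFactorizationMonoid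

variable {F K : Type*} [Field F] [NumberField F] [Field K] [NumberField K] [Algebra F K]

/-- The multiplicity of a prime in the extended ideal is its ramification index. -/
theorem squarefree_map_of_unramified (h : UnramifiedAtFinitePrimes F K) (p : Ideal (𝓞 F))
    [p.IsPrime] (hp : p ≠ ⊥) : Squarefree (p.map (algebraMap (𝓞 F) (𝓞 K))) := by
  classical
  have hp' : p.map (algebraMap (𝓞 F) (𝓞 K)) ≠ ⊥ := Ideal.map_ne_bot_of_ne_bot hp
  rw [squarefree_iff_nodup_normalizedFactors hp', Multiset.nodup_iff_count_le_one]
  intro P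
  by_cases hP : P ∈ normalizedFactors (p.map (algebraMap (𝓞 F) (𝓞 K)))
  · have hPp := (Ideal.mem_normalizedFactors_iff hp').mp hP
    have := hPp.1
    have hP0 : P ≠ ⊥ := ne_bot_of_le_ne_bot hp' hPp.2
    have : p.IsMaximal := Ring.DimensionLEOne.maximalOfPrime hp inferInstance
    have : P.LiesOver p := ⟨this.eq_of_le (Ideal.IsPrime.under _ P).ne_top (map_le_iff_le_comap.mp hPp.2)⟩
    have := h P hP0
    rw [← IsDedekindDomain.ramificationIdx_eq_normalizedFactors_count p P hp', ramificationIdx_eq_one]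
  · rw [Multiset.count_eq_zero_of_notMem hP]
    exact zero_le_one

theorem smul_map_algebraMap [IsGalois F K] (g : Gal(K/F)) (p : Ideal (𝓞 F)) :
    g • p.map (algebraMap (𝓞 F) (𝓞 K)) = p.map (algebraMap (𝓞 F) (𝓞 K)) := by
  rw [Ideal.pointwise_smul_def, Ideal.map_map]
  congr 1
  ext1 x
  have := IsGaloisGroup.of_isFractionRing Gal(K/F) (𝓞 F) (𝓞 K) F K
  exact smul_algebraMap g x

/-- In an unramified Galois extension every invariant ideal comes from below. -/
theorem exists_eq_map_of_invariant [IsGalois F K] (h : UnramifiedAtFinitePrimes F K)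
    (I : Ideal (𝓞 K)) (hI0 : I ≠ ⊥) (hI : ∀ g : Gal(K/F), g • I = I) :
    ∃ J : Ideal (𝓞 F), I = J.map (algebraMap (𝓞 F) (𝓞 K)) := by
  classical
  have := IsGaloisGroup.of_isFractionRing Gal(K/F) (𝓞 F) (𝓞 K) F K
  induction I using IsNoetherian.induction with
  | hgt I ih =>
  by_cases htop : I = ⊤
  · exact ⟨⊤, by rw [htop, Ideal.map_top]⟩
  obtain ⟨P, hP, hIP⟩ := Ideal.exists_le_maximal I htop
  have hP0 : P ≠ ⊥ := ne_bot_of_le_ne_bot hI0 hIP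
  let p := P.under (𝓞 F)
  have hp0 : p ≠ ⊥ := mt Ideal.eq_bot_of_comap_eq_bot hP0
  have hp' : p.map (algebraMap (𝓞 F) (𝓞 K)) ≠ ⊥ := Ideal.map_ne_bot_of_ne_bot hp0
  have : p.IsMaximal := Ideal.IsMaximal.under _ P
  -- The primes above `p` are conjugate to `P`, so each divides the invariant ideal `I`;
  -- squarefreeness lets their product divide it. The quotient is again invariant and strictly
  -- larger, so Noetherian induction applies.
  have hdvd : p.map (algebraMap (𝓞 F) (𝓞 K)) ∣ I := by
    rw [dvd_iff_normalizedFactors_le_normalizedFactors hp' hI0, Multiset.le_iff_subset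
      ((squarefree_iff_nodup_normalizedFactors hp').mp (squarefree_map_of_unramified h p hp0))]
    intro Q hQ
    obtain ⟨hQprime, hQp⟩ := (Ideal.mem_normalizedFactors_iff hp').mp hQ
    have : Q.LiesOver p :=
      ⟨this.eq_of_le (Ideal.IsPrime.under _ Q).ne_top (map_le_iff_le_comap.mp hQp)⟩
    obtain ⟨g, rfl⟩ := exists_smul_eq_of_isGaloisGroup p P Q Gal(K/F)
    refine (Ideal.mem_normalizedFactors_iff hI0).mpr ⟨hQprime, ?_⟩
    rw [← hI g]
    exact Ideal.pointwise_smul_le_pointwise_smul_iff.mpr hIP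
  obtain ⟨J, rfl⟩ := hdvd
  have hJ0 : J ≠ ⊥ := by
    rintro rfl
    exact hI0 (Ideal.mul_bot _)
  have hlt : p.map (algebraMap (𝓞 F) (𝓞 K)) * J < J := by
    refine lt_of_le_of_ne Ideal.mul_le_right fun heq => ?_
    have h1 : p.map (algebraMap (𝓞 F) (𝓞 K)) = 1 :=
      mul_right_cancel₀ hJ0 (heq.trans (one_mul J).symm)
    have h2 : p.map (algebraMap (𝓞 F) (𝓞 K)) ≤ P := Ideal.map_comap_le
    exact hP.ne_top (top_le_iff.mp (by rwa [h1, Ideal.one_eq_top] at h2))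
  obtain ⟨J', rfl⟩ := ih J hlt hJ0 fun g => by
    have := hI g
    rw [smul_mul', smul_map_algebraMap] at this
    exact mul_left_cancel₀ hp' this
  exact ⟨p * J', (Ideal.map_mul _ _ _).symm⟩

end InvariantIdeals

/-! ### Unramified quadratic extensions force an even class number -/

section QuadraticClassNumber

open NumberField Ideal Pointwise Module

variable {F K : Type*} [Field F] [NumberField F] [Field K] [NumberField K] [Algebra F K]
  [IsGalois F K]

/-- The action of an automorphism on the unit group, written additively. -/
noncomputable def unitsAction (τ : Gal(K/F)) : Additive (𝓞 K)ˣ →ₗ[ℤ] Additive (𝓞 K)ˣ :=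
  (MonoidHom.toAdditive (Units.map
    (MulSemiringAction.toRingHom Gal(K/F) (𝓞 K) τ : 𝓞 K →* 𝓞 K))).toIntLinearMap

omit [NumberField F] [NumberField K] [IsGalois F K] in
theorem coe_unitsAction (τ : Gal(K/F)) (u : Additive (𝓞 K)ˣ) :
    ((unitsAction τ u).toMul : 𝓞 K) = τ • (u.toMul : 𝓞 K) := rfl

theorem exists_algebraMap_eq_of_forall_smul_eq (x : 𝓞 K) (hx : ∀ g : Gal(K/F), g • x = x) :
    ∃ y : 𝓞 F, algebraMap (𝓞 F) (𝓞 K) y = x := by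
  have := IsGaloisGroup.of_isFractionRing Gal(K/F) (𝓞 F) (𝓞 K) F K
  exact Algebra.IsInvariant.isInvariant (G := Gal(K/F)) x hx

theorem finrank_ker_unitsAction_sub_id (τ : Gal(K/F)) (hτ : ∀ g : Gal(K/F), g = 1 ∨ g = τ) :
    finrank ℤ (LinearMap.ker (unitsAction τ - LinearMap.id)) = Units.rank F := by
  have hgal := IsGaloisGroup.of_isFractionRing Gal(K/F) (𝓞 F) (𝓞 K) F K
  have hinj : Function.Injective (algebraMap (𝓞 F) (𝓞 K)) := FaithfulSMul.algebraMap_injective _ _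
  let i : Additive (𝓞 F)ˣ →ₗ[ℤ] Additive (𝓞 K)ˣ :=
    (MonoidHom.toAdditive (Units.map (algebraMap (𝓞 F) (𝓞 K) : 𝓞 F →* 𝓞 K))).toIntLinearMap
  have hi : Function.Injective i := Units.map_injective hinj
  have hrange : LinearMap.ker (unitsAction τ - LinearMap.id) = LinearMap.range i := by
    ext u
    rw [LinearMap.mem_ker, LinearMap.sub_apply, sub_eq_zero]
    constructor
    · intro hu
      have hfix : ∀ v : (𝓞 K)ˣ, τ • (v : 𝓞 K) = v → ∀ g : Gal(K/F), g • (v : 𝓞 K) = v := by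
        intro v hv g
        rcases hτ g with rfl | rfl
        · exact one_smul _ _
        · exact hv
      have hu' : ∀ w : Additive (𝓞 K)ˣ, unitsAction τ w = w → τ • (w.toMul : 𝓞 K) = w.toMul :=
        fun w hw => by rw [← coe_unitsAction, hw]
      obtain ⟨x, hx⟩ := exists_algebraMap_eq_of_forall_smul_eq _ (hfix _ (hu' u hu))
      -- The inverse must descend too, so that the element found below is a unit of `𝓞 F`.
      obtain ⟨y, hy⟩ := exists_algebraMap_eq_of_forall_smul_eq _
        (hfix _ (hu' (-u) (by rw [map_neg]; exact congrArg _ hu)))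
      have hxy : x * y = 1 := hinj (by
        rw [map_mul, hx, hy, map_one, ← Units.val_mul, ← toMul_add, add_neg_cancel]; rfl)
      exact ⟨Additive.ofMul (Units.mkOfMulEqOne x y hxy),
        Additive.toMul.injective (Units.ext hx)⟩
    · rintro ⟨v, rfl⟩
      apply Additive.toMul.injective
      apply Units.ext
      rw [coe_unitsAction]
      exact smul_algebraMap τ ((v.toMul : (𝓞 F)ˣ) : 𝓞 F)
  rw [← Units.finrank_eq, ← LinearMap.finrank_range_of_inj hi, hrange]

/-- A nontrivial class in the first cohomology of the units. Without ramification at infinity the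
number of infinite places doubles, so the unit rank becomes `2 r + 1`; the only unit of order 2 is
-1. -/
theorem exists_unit_of_unramified_quadratic [IsUnramifiedAtInfinitePlaces F K]
    (h2 : finrank F K = 2) (τ : Gal(K/F)) (hτ : ∀ g : Gal(K/F), g = 1 ∨ g = τ) (hτ2 : τ * τ = 1) :
    ∃ ε : (𝓞 K)ˣ, τ • (ε : 𝓞 K) = ((ε⁻¹ : (𝓞 K)ˣ) : 𝓞 K) ∧
      ∀ η : (𝓞 K)ˣ, τ • (η : 𝓞 K) ≠ ε * η := by
  have hrank : finrank ℤ (Additive (𝓞 K)ˣ) = 2 * Units.rank F + 1 := by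
    rw [Units.finrank_eq, Units.rank, Units.rank,
      IsUnramifiedAtInfinitePlaces.card_infinitePlace F K, h2]
    have : 0 < Fintype.card (InfinitePlace F) := Fintype.card_pos
    omega
  obtain ⟨x, hx, hne⟩ := exists_map_eq_neg_and_forall_ne (unitsAction τ)
    (fun u => by
      apply Additive.toMul.injective
      apply Units.ext
      rw [coe_unitsAction, coe_unitsAction, smul_smul, hτ2, one_smul])
    hrank (finrank_ker_unitsAction_sub_id τ hτ) (e := Additive.ofMul (-1))
    (fun h => by
      have : (-1 : 𝓞 K) = 1 := congrArg (fun u : Additive (𝓞 K)ˣ => (u.toMul : 𝓞 K)) h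
      norm_num at this)
    (fun u => by
      have : 2 • u = 0 ↔ (u.toMul : 𝓞 K) * u.toMul = 1 := by
        rw [two_nsmul, ← Units.val_mul, ← toMul_add, Units.val_eq_one]; rfl
      rw [this, mul_self_eq_one_iff]
      refine or_congr ?_ ?_
      · rw [Units.val_eq_one]; rfl
      · rw [← Units.val_one, ← Units.val_neg, Units.val_inj]; rfl)
    (by
      apply Additive.toMul.injective
      apply Units.ext
      rw [coe_unitsAction]
      simp)
  refine ⟨x.toMul, ?_, fun η hη => hne (Additive.ofMul η) ?_⟩
  · rw [← coe_unitsAction, hx]; rfl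
  · rw [sub_eq_iff_eq_add]
    apply Additive.toMul.injective
    apply Units.ext
    rw [coe_unitsAction]
    exact hη

/-- A quadratic extension unramified at all places has a base field of even class number. -/
theorem even_classNumber_of_unramified_quadratic [IsUnramifiedAtInfinitePlaces F K]
    (h2 : finrank F K = 2) (hun : UnramifiedAtFinitePrimes F K) : Even (classNumber F) := by
  have hgal := IsGaloisGroup.of_isFractionRing Gal(K/F) (𝓞 F) (𝓞 K) F K
  have hinj : Function.Injective (algebraMap (𝓞 F) (𝓞 K)) := FaithfulSMul.algebraMap_injective _ _
  have hcard : Nat.card Gal(K/F) = 2 := (IsGalois.card_aut_eq_finrank F K).trans h2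
  obtain ⟨τ, hτ1, hτu⟩ := (Nat.card_eq_two_iff' (1 : Gal(K/F))).mp hcard
  have hτ : ∀ g : Gal(K/F), g = 1 ∨ g = τ := fun g => or_iff_not_imp_left.mpr (hτu g)
  have hτ2 : τ * τ = 1 := by
    rw [← sq, ← hcard]; exact pow_card_eq_one'
  obtain ⟨ε, hε, hne⟩ := exists_unit_of_unramified_quadratic h2 τ hτ hτ2
  -- Hilbert 90: `1 + τ • ε` works unless it vanishes, that is unless `ε = -1`; then `x - τ • x`
  -- works for any `x` that is moved.
  obtain ⟨a, ha0, ha⟩ : ∃ a : 𝓞 K, a ≠ 0 ∧ τ • a = ε * a := by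
    by_cases h : (ε : 𝓞 K) = -1
    · obtain ⟨x, hx⟩ : ∃ x : 𝓞 K, τ • x ≠ x := by
        by_contra! hfix
        exact hτ1 (hgal.faithful.eq_of_smul_eq_smul fun x => by rw [hfix, one_smul])
      refine ⟨x - τ • x, sub_ne_zero.mpr hx.symm, ?_⟩
      rw [smul_sub, smul_smul, hτ2, one_smul, h]
      ring
    · refine ⟨1 + τ • (ε : 𝓞 K), fun h0 => h ?_, ?_⟩
      · have := congrArg (τ • ·) (eq_neg_of_add_eq_zero_right h0)
        simpa [smul_smul, hτ2] using this
      · rw [smul_add, smul_one, smul_smul, hτ2, one_smul, hε, mul_add, mul_one, Units.mul_inv,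
          add_comm]
  obtain ⟨J, hJ⟩ := exists_eq_map_of_invariant hun (span {a}) (by simpa using ha0) (by
    intro g
    rcases hτ g with rfl | rfl
    · exact one_smul _ _
    · rw [Ideal.pointwise_smul_def, Ideal.map_span, Set.image_singleton]
      change span {g • a} = _
      rw [ha, mul_comm]
      exact Ideal.span_singleton_mul_right_unit ε.isUnit a)
  have hJ0 : J ≠ ⊥ := by
    rintro rfl
    rw [Ideal.map_bot, span_singleton_eq_bot] at hJ
    exact ha0 hJ
  -- If `b` generated `J`, then `a = b * η` with `η` a unit, and `τ • η = ε * η` since `b` is fixed.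
  have hJ1 : ¬ J.IsPrincipal := by
    rintro ⟨b, rfl⟩
    rw [submodule_span_eq, Ideal.map_span, Set.image_singleton, span_singleton_eq_span_singleton] at hJ
    obtain ⟨η, hη⟩ := hJ.symm
    refine hne η ?_
    have hb0 : algebraMap (𝓞 F) (𝓞 K) b ≠ 0 := by
      rintro h0
      rw [h0, zero_mul] at hη
      exact ha0 hη.symm
    apply mul_left_cancel₀ hb0
    rw [← smul_algebraMap τ b, ← smul_mul', hη, ha, smul_algebraMap, ← hη]
    ring
  -- The relative norm of the extended ideal is `J ^ 2`, and that of a principal ideal is principal.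
  have hJ2 : (J ^ 2).IsPrincipal := by
    have := relNorm_algebraMap (S := 𝓞 K) J
    rw [← hJ, relNorm_singleton, ← IsFractionRing.finrank_eq (𝓞 F) F (𝓞 K) K, h2] at this
    exact ⟨_, this.symm⟩
  let J' : nonZeroDivisors (Ideal (𝓞 F)) := ⟨J, mem_nonZeroDivisors_of_ne_zero hJ0⟩
  have horder : orderOf (ClassGroup.mk0 J') = 2 := by
    refine orderOf_eq_prime ?_ fun h => hJ1 ((ClassGroup.mk0_eq_one_iff _).mp h)
    rw [← map_pow, ClassGroup.mk0_eq_one_iff]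
    exact hJ2
  rw [even_iff_two_dvd, classNumber, ← horder]
  exact orderOf_dvd_card

end QuadraticClassNumber

/-! ### Galois groups over fields of odd class number -/

section GaloisGroups

open NumberField Ideal Pointwise Module

variable {F L : Type*} [Field F] [NumberField F] [Field L] [NumberField L] [Algebra F L]
  [IsGalois F L]

theorem eq_top_of_odd_classNumber (hodd : Odd (classNumber F)) {n : ℕ} (hn : finrank F L = 2 ^ n)
    (N : Subgroup Gal(L/F))
    (hfin : ∀ (P : Ideal (𝓞 L)) [P.IsPrime], P ≠ ⊥ → P.toAddSubgroup.inertia Gal(L/F) ≤ N)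
    (hinf : ∀ w : InfinitePlace L, MulAction.stabilizer Gal(L/F) w ≤ N) : N = ⊤ := by
  refine (eq_top_or_exists_unramified_quadratic hn N hfin hinf).resolve_right ?_
  rintro ⟨K, h2, hfinK, hinfK⟩
  have : Algebra.IsQuadraticExtension F K := { finrank_eq_two' := h2 }
  exact (Nat.not_even_iff_odd.mpr hodd) (even_classNumber_of_unramified_quadratic h2 hfinK)

theorem orderOf_eq_two_of_mem_inertia {k : IntermediateField F L} (hk : finrank F k = 2)
    (hun : UnramifiedAtFinitePrimes k L) (P : Ideal (𝓞 L)) [P.IsPrime] (hP : P ≠ ⊥)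
    {σ : Gal(L/F)} (hσ : σ ∈ P.toAddSubgroup.inertia Gal(L/F)) (h1 : σ ≠ 1) :
    σ ∉ k.fixingSubgroup ∧ orderOf σ = 2 := by
  have hbot := inertia_inf_fixingSubgroup_eq_bot k P (hun P hP)
  have hindex : k.fixingSubgroup.index = 2 := by
    rw [← IntermediateField.finrank_eq_fixingSubgroup_index, hk]
  have hmem : ∀ g ∈ P.toAddSubgroup.inertia Gal(L/F), g ∈ k.fixingSubgroup → g = 1 := by
    intro g h h'
    rw [← Subgroup.mem_bot, ← hbot]
    exact ⟨h, h'⟩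
  -- Squares lie in any subgroup of index 2, so `σ * σ` is in the trivial intersection.
  refine ⟨fun h => h1 (hmem σ hσ h), orderOf_eq_prime ?_ h1⟩
  rw [sq]
  exact hmem _ (mul_mem hσ hσ) (Subgroup.mul_self_mem_of_index_two hindex σ)

omit [NumberField F] [NumberField L] [IsGalois F L] in
theorem orderOf_eq_two_of_mem_stabilizer (w : InfinitePlace L) {σ : Gal(L/F)}
    (hσ : σ ∈ MulAction.stabilizer Gal(L/F) w) (h1 : σ ≠ 1) : orderOf σ = 2 := by
  refine orderOf_eq_prime ?_ h1
  have hd : orderOf (⟨σ, hσ⟩ : MulAction.stabilizer Gal(L/F) w) ∣ 2 := by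
    have := orderOf_dvd_natCard (⟨σ, hσ⟩ : MulAction.stabilizer Gal(L/F) w)
    rcases InfinitePlace.nat_card_stabilizer_eq_one_or_two F w with h | h <;> rw [h] at this
    · exact this.trans (one_dvd 2)
    · exact this
  exact congrArg Subtype.val (orderOf_dvd_iff_pow_eq_one.mp hd)

theorem le_closure_of_forall_ne_one {G : Type*} [Group G] {H : Subgroup G} {S : Set G}
    (h : ∀ g ∈ H, g ≠ 1 → g ∈ S) : H ≤ Subgroup.closure S := fun g hg => by
  by_cases h1 : g = 1
  · rw [h1]; exact one_mem _
  · exact Subgroup.subset_closure (h g hg h1)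

/-- All involutions are admitted as generators, since an infinite place that ramifies in L/k has a
nontrivial stabilizer inside Gal(L/k). This determines the group, but not the pair. -/
theorem isTableGroup_gal (hodd : Odd (classNumber F)) (h16 : finrank F L = 16)
    (hna : ¬ ∀ σ τ : Gal(L/F), σ * τ = τ * σ) {k : IntermediateField F L} (hk : finrank F k = 2)
    (hun : UnramifiedAtFinitePrimes k L) : IsTableGroup Gal(L/F) := by
  have hG : Nat.card Gal(L/F) = 16 := (IsGalois.card_aut_eq_finrank F L).trans h16
  refine (isTable_of_closure_involutions hG hna {σ | orderOf σ = 2} (fun s hs => ?_) ?_).1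
  · rw [← sq, ← (show orderOf s = 2 from hs), pow_orderOf_eq_one]
  · refine eq_top_of_odd_classNumber hodd (n := 4) h16 _ (fun P _ hP => ?_) fun w => ?_
    · exact le_closure_of_forall_ne_one fun g hg h1 =>
        (orderOf_eq_two_of_mem_inertia hk hun P hP hg h1).2
    · exact le_closure_of_forall_ne_one fun g hg h1 => orderOf_eq_two_of_mem_stabilizer w hg h1

theorem isTablePair_gal (hodd : Odd (classNumber F)) (h16 : finrank F L = 16)
    (hna : ¬ ∀ σ τ : Gal(L/F), σ * τ = τ * σ) {k : IntermediateField F L} (hk : finrank F k = 2)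
    (hun : UnramifiedAtFinitePrimes k L) (hinf : IsUnramifiedAtInfinitePlaces k L) :
    IsTablePair Gal(L/F) Gal(L/k) := by
  have hG : Nat.card Gal(L/F) = 16 := (IsGalois.card_aut_eq_finrank F L).trans h16
  have hindex : k.fixingSubgroup.index = 2 := by
    rw [← IntermediateField.finrank_eq_fixingSubgroup_index, hk]
  refine (isTablePair_of_generatedByInvolutionsOutside hG hna hindex ?_).of_mulEquiv
    (MulEquiv.refl _) (IntermediateField.fixingSubgroupEquiv k).symm
  refine eq_top_of_odd_classNumber hodd (n := 4) h16 _ (fun P _ hP => ?_) fun w => ?_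
  · exact le_closure_of_forall_ne_one fun g hg h1 =>
      orderOf_eq_two_of_mem_inertia hk hun P hP hg h1
  · exact le_closure_of_forall_ne_one fun g hg h1 =>
      ⟨fun h => h1 (eq_one_of_mem_stabilizer_of_isUnramified k w (hinf.isUnramified w) h hg),
        orderOf_eq_two_of_mem_stabilizer w hg h1⟩

end GaloisGroups

theorem mainTheorem8 :
    -- the pairs `(G, H)`, up to isomorphism, are exactly those of the table
    (∀ (G : Type*) (K : Type*) [Group G] [Group K],
      (Nat.card G = 16 ∧ (¬ ∀ a b : G, a * b = b * a) ∧
        ∃ H : Subgroup G, H.index = 2 ∧ Nonempty (H ≃* K) ∧ GeneratedByInvolutionsOutside H) ↔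
      IsTablePair G K) ∧
    -- the four pairs of the table are pairwise distinct
    (IsEmpty (DihedralGroup 8 ≃* (Cyc 2 × DihedralGroup 4)) ∧
      IsEmpty (DihedralGroup 8 ≃* C4CentralD4) ∧
      IsEmpty ((Cyc 2 × DihedralGroup 4) ≃* C4CentralD4) ∧
      IsEmpty ((Cyc 4 × Cyc 2) ≃* DihedralGroup 4)) ∧
    -- the consequence for Galois groups over number fields of odd class number
    (∀ (F : Type*) (L : Type*) [Field F] [NumberField F] [Field L] [Algebra F L]
      [IsGalois F L],
      Odd (NumberField.classNumber F) →
      Module.finrank F L = 16 →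
      (¬ ∀ σ τ : L ≃ₐ[F] L, σ * τ = τ * σ) →
      ∀ k : IntermediateField F L, Module.finrank F k = 2 →
        UnramifiedAtFinitePrimes k L →
        IsTableGroup (L ≃ₐ[F] L) ∧
        (IsUnramifiedAtInfinitePlaces k L →
          IsTablePair (L ≃ₐ[F] L) (L ≃ₐ[k] L))) := by
  refine ⟨fun G K _ _ => hasInvolutoryPair_iff_isTablePair,
    ⟨isEmpty_dihedral_eight_of_pow_four pow_four_cyc_two_prod_dihedral,
      isEmpty_dihedral_eight_of_pow_four pow_four_C4CentralD4,
      isEmpty_cyc_two_prod_dihedral_C4CentralD4, isEmpty_cyc_four_prod_cyc_two_dihedral⟩, ?_⟩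
  intro F L _ _ _ _ _ hodd h16 hna k hk hun
  have : FiniteDimensional F L := Module.finite_of_finrank_pos (by omega)
  have : NumberField L := NumberField.of_module_finite F L
  exact ⟨isTableGroup_gal hodd h16 hna hk hun,
    fun hinf => isTablePair_gal hodd h16 hna hk hun hinf⟩
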